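/- Let $\mathbb T^n=\mathbb R^n/\mathbb Z^n$. Let $H\in C^2(\mathbb T^n\times\mathbb R^n)$ be strictly convex and superlinear in $p$ (that is, $H(x,p)/|p|\to\infty$ as $|p|\to\infty$ for each $x$), and suppose that there is $\gamma_1>0$ with $|D_xH(x,p)|\le\gamma_1\,(1+|H(x,p)|)$ for all $(x,p)$. Let $A\in C^2(\mathbb T^n)$ take values in the symmetric positive semidefinite $n\times n$ matrices, and let $c_0\in\mathbb R$. Let $w\in\mathrm{Lip}(\mathbb T^n)$ be a viscosity subsolution of $$H(x,Dw)\le \mathrm{tr}\big(A(x)D^2w\big)+c_0\qquad\text{in }\mathbb T^n,$$ that is, $H(x,D\varphi(x))\le \mathrm{tr}(A(x)D^2\varphi(x))+c_0$ whenever $\varphi$ is $C^2$ and $w-\varphi$ has a local maximum at $x$. Then there is a constant $C>0$ such that for every $\eta\in(0,1)$ there exists $w_\eta\in C^\infty(\mathbb T^n)$ with $$\|w_\eta-w\|_{L^\infty(\mathbb T^n)}\le C\eta$$ and $$-\eta^2\Delta w_\eta(x)-\mathrm{tr}\big(A(x)D^2w_\eta(x)\big)+H\big(x,Dw_\eta(x)\big)\le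 c_0+C\eta\qquad\text{for all }x\in\mathbb T^n.$$ The constant $C$ does not depend on $\eta$. -/

import Mathlib

open scoped ContDiff

/-- `ℝⁿ` with its Euclidean norm; points of the torus `𝕋ⁿ = ℝⁿ / ℤⁿ` are represented by points of
`ℝⁿ`, and functions on the torus by `ℤⁿ`-periodic functions on `ℝⁿ`. -/
abbrev RSpace (n : ℕ) : Type := EuclideanSpace ℝ (Fin n)

/-- `f` is `ℤⁿ`-periodic, that is, `f` is (the lift of) a function on the flat torus `ℝⁿ / ℤⁿ`. -/
def ZPeriodic {n : ℕ} {α : Type*} (f : RSpace n → α) : Prop :=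
  ∀ (k : Fin n → ℤ) (x : RSpace n), f (x + WithLp.toLp 2 (fun i => (k i : ℝ))) = f x

/-- The Hessian matrix `D²φ(x)`, with entries `∂ᵢ∂ⱼφ(x)`. -/
noncomputable def hessianMatrix {n : ℕ} (φ : RSpace n → ℝ) (x : RSpace n) :
    Matrix (Fin n) (Fin n) ℝ :=
  Matrix.of fun i j =>
    iteratedFDeriv ℝ 2 φ x ![EuclideanSpace.single i 1, EuclideanSpace.single j 1]

/-- The second order term `tr (A(x) D²φ(x))`. -/
noncomputable def diffusionTerm {n : ℕ} (A : RSpace n → Matrix (Fin n) (Fin n) ℝ)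
    (φ : RSpace n → ℝ) (x : RSpace n) : ℝ :=
  Matrix.trace (A x * hessianMatrix φ x)

/-- `w` (assumed continuous where this is used) is a viscosity subsolution of
`H(x, Dw) ≤ tr (A(x) D²w) + c₀`: whenever `φ` is a `C²` test function such that `w - φ` has a
local maximum at `x`, the inequality holds for `φ` at `x`. -/
def IsViscositySubsolution {n : ℕ} (H : RSpace n → RSpace n → ℝ)
    (A : RSpace n → Matrix (Fin n) (Fin n) ℝ) (c₀ : ℝ) (w : RSpace n → ℝ) : Prop :=
  ∀ (φ : RSpace n → ℝ) (x : RSpace n), ContDiff ℝ 2 φ →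
    IsLocalMax (fun y => w y - φ y) x →
      H x (gradient φ x) ≤ diffusionTerm A φ x + c₀

/-! The regularization is a sup-convolution `u` of `w` at scale `η`, mollified at radius `η²`. Since
`w` is Lipschitz, the maximizer `ζ y` lies within `2Lη` of `y`, the momentum `(ζ y - y)/η` has norm
at most `2L`, and `u + |·|²/(2η)` is convex. Alexandrov's theorem
(`ae_exists_hasFDerivAt_subgradient`) then gives a second order expansion of `u` almost everywhere,
with Hessian `Y - η⁻¹`, `Y ≥ 0`.

The difficulty is that the subsolution inequality holds at `ζ y`, with matrix `A (ζ y)`, while `D²u`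
may have size `1/η` and `|A (ζ y) - A y|` is only `O(η)`. The remedy is the matrix estimate of the
doubling method, obtained by hand: displacements `v` from `ζ y` are transported to displacements `(1
+ N) v` from `y`, at a cost `η⁻¹|N v|²` (`IsViscositySubsolution.le_of_hasFDerivAt`). A good `N`
comes from comparing square roots of `A (ζ y) + η²` and `A y + η²`, which differ by `O(η)` because a
nonnegative `C²` matrix field satisfies Glaeser's inequality (`exists_glaeser_bound`,
`exists_sqrt_perturbation`). The total error is `O(η)`.

Mollification replaces `A y` by `A x` with `|y - x| ≤ η²`. Since `Y ≥ 0`, this `O(η²)` discrepancy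
is absorbed by the added viscosity `K η²`, and the trace term `η⁻¹ · O(η²)` is again `O(η)`
(`IsViscositySubsolution.le_sum_second_order`). Convexity of `H x` reduces the inequality to one
that is linear in `(Du, D²u)`, which survives averaging; the singular part of `D²u` has the
favourable sign (`le_of_ae_le_differenceQuotient`). Running this at scale `η/K₁` with `K = K₁²`
makes the added viscosity exactly `η²`. -/

section Regularization

open Filter Topology MeasureTheory InnerProductSpace

/-! ### Calculus preliminaries: minimization and second differences. -/

/-- A continuous function on a proper space that grows quadratically attains its minimum. -/
lemma exists_forall_le_of_quadratic_growth {E : Type*} [NormedAddCommGroup E] [ProperSpace E]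
    {F : E → ℝ} (hF : Continuous F) {a b c : ℝ} (x : E) (ha : 0 < a)
    (h : ∀ z, a * ‖z - x‖ ^ 2 - b * ‖z - x‖ - c ≤ F z) : ∃ z, ∀ z', F z ≤ F z' := by
  have h1 : Tendsto (fun z : E => ‖z - x‖) (cocompact E) atTop := by
    have := tendsto_dist_right_cocompact_atTop x
    simpa [dist_eq_norm] using this
  have h2 : Tendsto (fun t : ℝ => a * t ^ 2 - b * t - c) atTop atTop := by
    have : Tendsto (fun t : ℝ => t * (a * t - b) - c) atTop atTop := by
      apply Filter.tendsto_atTop_add_const_right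
      apply Filter.Tendsto.atTop_mul_atTop₀ tendsto_id
      apply Filter.tendsto_atTop_add_const_right
      exact Filter.Tendsto.const_mul_atTop ha tendsto_id
    refine this.congr fun t => by ring
  exact hF.exists_forall_le (tendsto_atTop_mono h (h2.comp h1))

/-- A function whose increments are bounded above by the square of the step is nonincreasing. -/
lemma le_of_increment_le_sq {h : ℝ → ℝ} {C : ℝ}
    (hh : ∀ s t, 0 ≤ s → s ≤ t → t ≤ 1 → h t - h s ≤ C * (t - s) ^ 2) : h 1 ≤ h 0 := by
  -- Telescoping over `N + 1` equal steps leaves a total of `C / (N + 1)`.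
  have key : ∀ N : ℕ, h 1 - h 0 ≤ C * (1 / ((N : ℝ) + 1)) := by
    intro N
    have hN : (0 : ℝ) < (N : ℝ) + 1 := by positivity
    have : ∑ i ∈ Finset.range (N + 1), (h (((i + 1 : ℕ) : ℝ) / (N + 1)) - h ((i : ℝ) / (N + 1)))
        ≤ ∑ i ∈ Finset.range (N + 1), C * (1 / ((N : ℝ) + 1)) ^ 2 := by
      refine Finset.sum_le_sum fun i hi => ?_
      have hi' : ((i : ℝ) + 1) ≤ N + 1 := by
        have := Finset.mem_range.1 hi
        exact_mod_cast this
      have := hh ((i : ℝ) / (N + 1)) (((i + 1 : ℕ) : ℝ) / (N + 1)) (by positivity)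
        (by push_cast; gcongr; linarith) (by push_cast; rw [div_le_one hN]; exact hi')
      refine this.trans (le_of_eq ?_)
      push_cast
      congr 2
      field_simp
      ring
    rw [Finset.sum_range_sub (fun i : ℕ => h ((i : ℝ) / (N + 1)))] at this
    simp only [Finset.sum_const, Finset.card_range, nsmul_eq_mul] at this
    push_cast at this
    rw [div_self hN.ne', zero_div] at this
    refine this.trans (le_of_eq ?_)
    field_simp
  have lim : Tendsto (fun N : ℕ => C * (1 / ((N : ℝ) + 1))) atTop (𝓝 (C * 0)) :=
    tendsto_one_div_add_atTop_nhds_zero_nat.const_mul C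
  have := ge_of_tendsto' lim key
  linarith

/-- The second difference quotient of a `C²` function converges to its second derivative. -/
lemma ContDiff.tendsto_second_difference {E : Type*} [NormedAddCommGroup E] [NormedSpace ℝ E]
    {f : E → ℝ} (hf : ContDiff ℝ 2 f) (x e : E) :
    Tendsto (fun h : ℝ => (f (x + h • e) + f (x - h • e) - 2 * f x) / h ^ 2) (𝓝[≠] 0)
      (𝓝 (iteratedFDeriv ℝ 2 f x ![e, e])) := by
  have hline : ∀ t : ℝ, HasDerivAt (fun t : ℝ => x + t • e) e t := fun t => by
    simpa using ((hasDerivAt_id t).smul_const e).const_add x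
  set G : ℝ → ℝ := fun t => f (x + t • e) with hG
  have hGc : ContDiff ℝ 2 G := hf.comp (contDiff_const.add (contDiff_id.smul contDiff_const))
  have hd : deriv G = fun t => fderiv ℝ f (x + t • e) e := by
    funext t
    exact ((hf.differentiable (by norm_num) _).hasFDerivAt.comp_hasDerivAt t (hline t)).deriv
  have hf1 : Differentiable ℝ (fderiv ℝ f) :=
    (hf.fderiv_right (m := 1) (by norm_num)).differentiable (by norm_num)
  have hdd : deriv (deriv G) 0 = iteratedFDeriv ℝ 2 f x ![e, e] := by
    rw [hd, iteratedFDeriv_two_apply]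
    have h1 := (hf1 (x + (0 : ℝ) • e)).hasFDerivAt.comp_hasDerivAt (0 : ℝ) (hline 0)
    have := (h1.clm_apply (hasDerivAt_const (0 : ℝ) e)).deriv
    simp only [map_zero, zero_smul, add_zero] at this
    simpa [Function.comp_def] using this
  have key := taylor_isLittleO_univ (x₀ := 0) (n := 2) hGc
  have ev : ∀ t, taylorWithinEval G 2 Set.univ 0 t
      = G 0 + t * deriv G 0 + t ^ 2 / 2 * deriv (deriv G) 0 := by
    intro t
    simp only [taylorWithinEval_succ, taylor_within_zero_eval, iteratedDerivWithin_univ,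
      iteratedDeriv_succ, iteratedDeriv_zero]
    norm_num
    left
    ring
  simp only [ev, sub_zero] at key
  have kt : Tendsto (fun t => (G t - (G 0 + t * deriv G 0 + t ^ 2 / 2 * deriv (deriv G) 0)) / t ^ 2)
      (𝓝[≠] 0) (𝓝 0) := (key.mono nhdsWithin_le_nhds).tendsto_div_nhds_zero
  have hneg : Tendsto (fun t : ℝ => -t) (𝓝[≠] 0) (𝓝[≠] 0) := by
    refine tendsto_nhdsWithin_of_tendsto_nhds_of_eventually_within _ ?_ ?_
    · simpa using (continuous_neg.tendsto (0 : ℝ)).mono_left nhdsWithin_le_nhds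
    · filter_upwards [self_mem_nhdsWithin] with t ht
      simpa using ht
  -- Adding the Taylor expansions at `t` and `-t` cancels the first order terms.
  have kk := (kt.add (kt.comp hneg)).add_const (deriv (deriv G) 0)
  rw [← hdd]
  simp only [add_zero, zero_add] at kk
  refine kk.congr' ?_
  filter_upwards [self_mem_nhdsWithin] with t ht
  have ht' : t ≠ 0 := ht
  simp only [Function.comp, hG]
  simp only [neg_smul, ← sub_eq_add_neg, zero_smul, add_zero]
  field_simp
  ring

/-- Second difference quotients at a point with a second order expansion. -/
lemma tendsto_second_difference_of_expansion {E : Type*} [NormedAddCommGroup E]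
    [NormedSpace ℝ E] {f : E → ℝ} {x : E} {l : E →L[ℝ] ℝ} {q : E → ℝ}
    (hq : ∀ (t : ℝ) v, q (t • v) = t ^ 2 * q v)
    (h : (fun v => f (x + v) - f x - l v - q v / 2) =o[𝓝 0] fun v => ‖v‖ ^ 2) (e : E) :
    Tendsto (fun h : ℝ => (f (x + h • e) + f (x - h • e) - 2 * f x) / h ^ 2) (𝓝[≠] 0)
      (𝓝 (q e)) := by
  have hl : ∀ e : E, Tendsto (fun t : ℝ => (f (x + t • e) - f x - l (t • e) - q (t • e) / 2) / t ^ 2)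
      (𝓝[≠] 0) (𝓝 0) := by
    intro e
    have h0 : Tendsto (fun t : ℝ => t • e) (𝓝[≠] 0) (𝓝 0) := by
      have : Continuous fun t : ℝ => t • e := by fun_prop
      simpa using (this.tendsto 0).mono_left nhdsWithin_le_nhds
    have h1 := h.comp_tendsto h0
    have h2 : ((fun v : E => ‖v‖ ^ 2) ∘ fun t : ℝ => t • e) =O[𝓝[≠] 0] fun t : ℝ => t ^ 2 := by
      refine Asymptotics.IsBigO.of_bound (‖e‖ ^ 2) (Eventually.of_forall fun t => ?_)
      simp [norm_smul, mul_pow, mul_comm]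
    exact (h1.trans_isBigO h2).tendsto_div_nhds_zero
  have kk := ((hl e).add (hl (-e))).add_const (q e)
  simp only [add_zero, zero_add] at kk
  refine kk.congr' ?_
  filter_upwards [self_mem_nhdsWithin] with t ht
  have ht' : t ≠ 0 := ht
  have h1 : q (-(t • e)) = t ^ 2 * q e := by rw [← neg_smul, hq]; ring
  have h2 : q (t • e) = t ^ 2 * q e := hq t e
  simp only [smul_neg, h1, h2, map_smul, map_neg, ← sub_eq_add_neg, smul_eq_mul]
  field_simp
  ring

/-! ### Subgradients of convex functions and Alexandrov's theorem. -/

section Subgradient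

variable {E : Type*} [NormedAddCommGroup E] [InnerProductSpace ℝ E]

/-- `p` is a subgradient of `f` at `x`. -/
def IsSubgradient (f : E → ℝ) (x p : E) : Prop := ∀ y, f x + ⟪p, y - x⟫_ℝ ≤ f y

lemma IsSubgradient.monotone {f : E → ℝ} {x y p q : E} (hp : IsSubgradient f x p)
    (hq : IsSubgradient f y q) : 0 ≤ ⟪p - q, x - y⟫_ℝ := by
  have h1 := hp y
  have h2 := hq x
  have h3 : ⟪p, y - x⟫_ℝ = -⟪p, x - y⟫_ℝ := by rw [← inner_neg_right, neg_sub]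
  rw [inner_sub_left]
  linarith

/-- Firm nonexpansiveness of the resolvent of the subdifferential. -/
lemma IsSubgradient.norm_sq_le_inner {f : E → ℝ} {x y p q : E} (hp : IsSubgradient f x p)
    (hq : IsSubgradient f y q) : ‖x - y‖ ^ 2 ≤ ⟪(x + p) - (y + q), x - y⟫_ℝ := by
  have h := hp.monotone hq
  have : (x + p) - (y + q) = (x - y) + (p - q) := by abel
  rw [this, inner_add_left, real_inner_self_eq_norm_sq]
  linarith

lemma IsSubgradient.norm_sub_le {f : E → ℝ} {x y p q : E} (hp : IsSubgradient f x p)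
    (hq : IsSubgradient f y q) : ‖x - y‖ ≤ ‖(x + p) - (y + q)‖ := by
  have h := (hp.norm_sq_le_inner hq).trans (real_inner_le_norm _ _)
  rcases (norm_nonneg (x - y)).eq_or_lt with h0 | h0
  · rw [← h0]; positivity
  · nlinarith

/-- A function with subgradients everywhere is convex. -/
lemma convexity_of_isSubgradient {f : E → ℝ} {s : E → E} (hs : ∀ x, IsSubgradient f x (s x))
    (x y : E) {t : ℝ} (h0 : 0 ≤ t) (h1 : t ≤ 1) :
    f (x + t • (y - x)) ≤ (1 - t) * f x + t * f y := by
  set z := x + t • (y - x) with hz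
  have e1 := hs z x
  have e2 := hs z y
  have i1 : x - z = (-t) • (y - x) := by rw [hz, neg_smul]; abel
  have i2 : y - z = (1 - t) • (y - x) := by rw [hz, sub_smul, one_smul]; abel
  rw [i1, inner_smul_right] at e1
  rw [i2, inner_smul_right] at e2
  nlinarith

/-- The expansion of a convex function at a point where a selection of subgradients is
differentiable. -/
lemma expansion_of_hasFDerivAt_subgradient {f : E → ℝ} {s : E → E}
    (hs : ∀ x, IsSubgradient f x (s x)) {x : E} {Y : E →L[ℝ] E} (hY : HasFDerivAt s Y x) :
    (fun v => f (x + v) - f x - ⟪s x, v⟫_ℝ - ⟪Y v, v⟫_ℝ / 2) =o[𝓝 0] fun v => ‖v‖ ^ 2 := by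
  rw [Asymptotics.isLittleO_iff]
  intro c hc
  have h0 := (hasFDerivAt_iff_isLittleO_nhds_zero.1 hY).def hc
  obtain ⟨r, hr, hball⟩ := Metric.eventually_nhds_iff.1 h0
  refine Metric.eventually_nhds_iff.2 ⟨r, hr, fun v hv => ?_⟩
  have hest : ∀ t : ℝ, 0 ≤ t → t ≤ 1 →
      |⟪s (x + t • v), v⟫_ℝ - ⟪s x, v⟫_ℝ - t * ⟪Y v, v⟫_ℝ| ≤ c * t * ‖v‖ ^ 2 := by
    intro t ht ht1
    have h1 := hball (y := t • v) (by
      rw [dist_zero_right] at hv ⊢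
      rw [norm_smul, Real.norm_eq_abs, abs_of_nonneg ht]
      nlinarith [norm_nonneg v])
    rw [norm_smul, Real.norm_eq_abs, abs_of_nonneg ht] at h1
    have h2 : ⟪s (x + t • v), v⟫_ℝ - ⟪s x, v⟫_ℝ - t * ⟪Y v, v⟫_ℝ
        = ⟪s (x + t • v) - s x - Y (t • v), v⟫_ℝ := by
      rw [inner_sub_left, inner_sub_left, map_smul, inner_smul_left]
      simp
    rw [h2]
    refine (abs_real_inner_le_norm _ _).trans ?_
    nlinarith [norm_nonneg v]
  have incr : ∀ a b : ℝ, f (x + b • v) - f (x + a • v) ≤ (b - a) * ⟪s (x + b • v), v⟫_ℝ := by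
    intro a b
    have := hs (x + b • v) (x + a • v)
    have e : x + a • v - (x + b • v) = (-(b - a)) • v := by
      rw [neg_smul, sub_smul]; abel
    rw [e, inner_smul_right] at this
    linarith
  set P := ⟪s x, v⟫_ℝ
  set Q := ⟪Y v, v⟫_ℝ
  set m := ‖v‖ ^ 2
  have hm : 0 ≤ m := by positivity
  -- In place of integrating `s` along the segment, `f` is compared with its quadratic model: using
  -- the subgradient at the far end, each increment is off by at most `(b - a)² Q / 2`, since `b (b
  -- - a) - (b² - a²)/2 = (b - a)²/2`. The lower bound uses the subgradient at the near end.
  have up : f (x + v) - f x - P - Q / 2 ≤ c * m := by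
    have := le_of_increment_le_sq (h := fun t => f (x + t • v) - t * P - t ^ 2 / 2 * Q
        - c * m * t) (C := |Q| / 2) (by
      intro a b ha hab hb
      have h1 := incr a b
      have h2 := (abs_le.1 (hest b (ha.trans hab) hb)).2
      have h3 := le_abs_self Q
      have h4 : (b - a) * (⟪s (x + b • v), v⟫_ℝ) ≤ (b - a) * (P + b * Q + c * m) :=
        mul_le_mul_of_nonneg_left (by nlinarith [mul_nonneg hc.le hm]) (by linarith)
      nlinarith [sq_nonneg (b - a)])
    simp only [one_smul, zero_smul, add_zero] at this
    linarith
  have lo : -(c * m) ≤ f (x + v) - f x - P - Q / 2 := by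
    have := le_of_increment_le_sq (h := fun t => -(f (x + t • v)) + t * P + t ^ 2 / 2 * Q
        - c * m * t) (C := |Q| / 2) (by
      intro a b ha hab hb
      have h1 := incr b a
      have h2 := (abs_le.1 (hest a ha (hab.trans hb))).1
      have h3 := le_abs_self Q
      have h4 : (b - a) * (P + a * Q - c * m) ≤ (b - a) * (⟪s (x + a • v), v⟫_ℝ) :=
        mul_le_mul_of_nonneg_left
          (by nlinarith [mul_nonneg (mul_nonneg hc.le hm) (by linarith : 0 ≤ 1 - a)])
          (by linarith)
      nlinarith [sq_nonneg (b - a)])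
    simp only [one_smul, zero_smul, add_zero] at this
    linarith
  rw [Real.norm_eq_abs, Real.norm_eq_abs, abs_of_nonneg hm]
  exact abs_le.2 ⟨lo, up⟩

variable [FiniteDimensional ℝ E]

/-- Surjectivity of `1 + ∂f`. -/
lemma exists_resolvent {f : E → ℝ} (hf : Continuous f) {s : E → E}
    (hs : ∀ x, IsSubgradient f x (s x)) (x : E) : ∃ z, IsSubgradient f z (x - z) := by
  have hp : ProperSpace E := FiniteDimensional.proper ℝ E
  obtain ⟨z, hz⟩ := exists_forall_le_of_quadratic_growth (F := fun z => f z + ‖z - x‖ ^ 2 / 2)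
    (a := 1 / 2) (b := ‖s x‖) (c := -f x) (by fun_prop) x (by norm_num) (fun z => by
      have h1 := hs x z
      have h2 := neg_le_of_abs_le (abs_real_inner_le_norm (s x) (z - x))
      linarith)
  refine ⟨z, fun y => ?_⟩
  -- First order condition at the minimizer `z`: compare with points of the segment towards `y`,
  -- divide by `t`, then let `t → 0`.
  have key : ∀ t : ℝ, 0 < t → t ≤ 1 → f z + ⟪x - z, y - z⟫_ℝ ≤ f y + t * (‖y - z‖ ^ 2 / 2) := by
    intro t ht ht1
    have h1 := hz (z + t • (y - z))
    have h2 := convexity_of_isSubgradient hs z y ht.le ht1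
    have h3 : z + t • (y - z) - x = (z - x) + t • (y - z) := by abel
    have h5 : ⟪z - x, y - z⟫_ℝ = - ⟪x - z, y - z⟫_ℝ := by rw [← inner_neg_left, neg_sub]
    rw [h3, norm_add_sq_real, inner_smul_right, norm_smul, mul_pow, Real.norm_eq_abs, sq_abs,
      h5] at h1
    have h4 : t * (f z + ⟪x - z, y - z⟫_ℝ) ≤ t * (f y + t * (‖y - z‖ ^ 2 / 2)) := by
      nlinarith
    exact le_of_mul_le_mul_left h4 ht
  have lim : Tendsto (fun t : ℝ => f y + t * (‖y - z‖ ^ 2 / 2)) (𝓝[>] 0) (𝓝 (f y)) := by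
    have : Continuous fun t : ℝ => f y + t * (‖y - z‖ ^ 2 / 2) := by fun_prop
    simpa using (this.tendsto 0).mono_left nhdsWithin_le_nhds
  refine ge_of_tendsto lim ?_
  filter_upwards [Ioc_mem_nhdsGT (zero_lt_one' ℝ)] with t ht using key t ht.1 ht.2

/-- A Lipschitz self-map of a finite dimensional space maps null sets to null sets. -/
lemma LipschitzWith.addHaar_image_eq_zero [MeasurableSpace E] [BorelSpace E] (μ : Measure E)
    [μ.IsAddHaarMeasure] {K : NNReal} {f : E → E} (hf : LipschitzWith K f) {s : Set E}
    (hs : μ s = 0) : μ (f '' s) = 0 := by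
  set ν : Measure E := Measure.hausdorffMeasure (Module.finrank ℝ E) with hν
  have h1 : ν s = 0 := Measure.absolutelyContinuous_isAddHaarMeasure ν μ hs
  have h2 : ν (f '' s) = 0 := by
    have := hf.hausdorffMeasure_image_le (d := Module.finrank ℝ E) (by positivity) s
    rw [← hν, h1, mul_zero] at this
    exact le_antisymm this bot_le
  exact Measure.absolutelyContinuous_isAddHaarMeasure μ ν h2

/-- **Alexandrov's theorem**: a selection of subgradients of a convex function is differentiable
almost everywhere. -/
theorem ae_exists_hasFDerivAt_subgradient [MeasurableSpace E] [BorelSpace E] (μ : Measure E)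
    [μ.IsAddHaarMeasure] {f : E → ℝ} (hf : Continuous f) {s : E → E}
    (hs : ∀ x, IsSubgradient f x (s x)) : ∀ᵐ x ∂μ, ∃ Y : E →L[ℝ] E, HasFDerivAt s Y x := by
  -- `P = (1 + ∂f)⁻¹` is 1-Lipschitz and a left inverse of `1 + s`. A point `z` is bad only if it is
  -- the image under `P` of a point where `P` is not differentiable (null by Rademacher and the
  -- Lipschitz bound) or has singular derivative (null by the Sard-type lemma). Elsewhere `1 + s` is
  -- differentiable as a local inverse.
  choose P hP using exists_resolvent hf hs
  have hPmono : ∀ x y, ‖P x - P y‖ ^ 2 ≤ ⟪x - y, P x - P y⟫_ℝ := fun x y => by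
    simpa using (hP x).norm_sq_le_inner (hP y)
  have hPlip : LipschitzWith 1 P := LipschitzWith.of_dist_le_mul fun x y => by
    simpa [dist_eq_norm] using (hP x).norm_sub_le (hP y)
  have hPg : ∀ z, P (z + s z) = z := fun z => by
    have := (hP (z + s z)).norm_sub_le (hs z)
    rw [add_sub_cancel, sub_self, norm_zero] at this
    exact sub_eq_zero.1 (norm_eq_zero.1 (le_antisymm this (norm_nonneg _)))
  set N1 := {x | ¬ DifferentiableAt ℝ P x}
  set N2 := {x | DifferentiableAt ℝ P x ∧ (fderiv ℝ P x).det = 0}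
  have hN1 : μ (P '' N1) = 0 :=
    hPlip.addHaar_image_eq_zero μ (ae_iff.1 hPlip.ae_differentiableAt)
  have hN2 : μ (P '' N2) = 0 :=
    addHaar_image_eq_zero_of_det_fderivWithin_eq_zero μ
      (fun x hx => hx.1.hasFDerivAt.hasFDerivWithinAt) fun x hx => hx.2
  have hN : μ (P '' N1 ∪ P '' N2) = 0 := measure_union_null hN1 hN2
  filter_upwards [measure_eq_zero_iff_ae_notMem.1 hN] with z hz
  set g : E → E := fun z => z + s z with hg
  have hgz1 : DifferentiableAt ℝ P (g z) := by
    by_contra h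
    exact hz (Or.inl ⟨g z, h, hPg z⟩)
  have hdet : (fderiv ℝ P (g z)).det ≠ 0 := fun h => hz (Or.inr ⟨g z, ⟨hgz1, h⟩, hPg z⟩)
  set Q : E ≃L[ℝ] E := (fderiv ℝ P (g z)).toContinuousLinearEquivOfDetNeZero hdet
  have hQ : HasFDerivAt P (Q : E →L[ℝ] E) (g z) := by
    simpa [Q] using hgz1.hasFDerivAt
  -- The inverse function argument needs continuity of `g`, which follows from monotonicity. If `g
  -- z'` were far from `g z`, the point `g z + v` at distance `r` on the segment between them is
  -- moved by `P` at least `c r / 2` away from `z`. Monotonicity of `P` along the segment then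
  -- bounds `⟪g z' - g z, z' - z⟫` below, which contradicts `‖z' - z‖ < (c/2)² r`.
  have hcont : ContinuousAt g z := by
    obtain ⟨c, hc, hQc⟩ : ∃ c > 0, ∀ v, c * ‖v‖ ≤ ‖Q v‖ := by
      refine ⟨(‖(Q.symm : E →L[ℝ] E)‖ + 1)⁻¹, by positivity, fun v => ?_⟩
      rw [inv_mul_le_iff₀ (by positivity)]
      have h := (Q.symm : E →L[ℝ] E).le_opNorm (Q v)
      simp only [ContinuousLinearEquiv.coe_coe, ContinuousLinearEquiv.symm_apply_apply] at h
      nlinarith [norm_nonneg (Q v)]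
    have h0 := (hasFDerivAt_iff_isLittleO_nhds_zero.1 hQ).def (half_pos hc)
    obtain ⟨r0, hr0, hball⟩ := Metric.eventually_nhds_iff.1 h0
    rw [Metric.continuousAt_iff]
    intro ε hε
    set r := min ε (r0 / 2) with hr
    have hrpos : 0 < r := lt_min hε (half_pos hr0)
    refine ⟨(c / 2) ^ 2 * r, by positivity, fun z' hz' => ?_⟩
    by_contra hcon
    rw [not_lt, dist_eq_norm] at hcon
    set d := ‖g z' - g z‖
    have hd : 0 < d := hε.trans_le hcon
    set t := r / d
    have ht0 : 0 < t := by positivity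
    have ht1 : t ≤ 1 := (div_le_one hd).2 ((min_le_left _ _).trans hcon)
    set v := t • (g z' - g z) with hv
    have hvn : ‖v‖ = r := by
      rw [hv, norm_smul, Real.norm_eq_abs, abs_of_pos ht0, div_mul_cancel₀ _ hd.ne']
    have hb := hball (y := v) (by
      rw [dist_zero_right, hvn]
      exact (min_le_right _ _).trans_lt (half_lt_self hr0))
    have hlow : c / 2 * r ≤ ‖P (g z + v) - P (g z)‖ := by
      have h1 := norm_sub_norm_le (Q v) (-(P (g z + v) - P (g z) - Q v))
      have h2 : Q v - -(P (g z + v) - P (g z) - Q v) = P (g z + v) - P (g z) := by abel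
      rw [h2, norm_neg] at h1
      have h3 := hQc v
      rw [hvn] at h3 hb
      have h4 : ‖P (g z + v) - P (g z) - Q v‖ ≤ c / 2 * r := hb
      linarith
    have m1 := hPmono (g z + v) (g z)
    rw [add_sub_cancel_left] at m1
    have m2 := (sq_nonneg _).trans (hPmono (g z') (g z + v))
    have e2 : g z' - (g z + v) = (1 - t) • (g z' - g z) := by
      rw [hv, sub_smul, one_smul]; abel
    rw [e2, inner_smul_left] at m2
    have e3 : ⟪g z' - g z, P (g z') - P (g z)⟫_ℝ = ⟪g z' - g z, P (g z') - P (g z + v)⟫_ℝ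
        + ⟪g z' - g z, P (g z + v) - P (g z)⟫_ℝ := by
      rw [← inner_add_right]; congr 1; abel
    rw [hv, inner_smul_left, ← hv] at m1
    simp only [conj_trivial] at m1 m2
    have hup := real_inner_le_norm (g z' - g z) (P (g z') - P (g z))
    rw [hPg z', hPg z] at hup e3
    rw [dist_eq_norm] at hz'
    have f1 : (c / 2 * r) ^ 2 ≤ ‖P (g z + v) - P (g z)‖ ^ 2 := by gcongr
    have f2 : 0 ≤ t * ⟪g z' - g z, z' - P (g z + v)⟫_ℝ := by
      rcases ht1.eq_or_lt with h | h
      · have : v = g z' - g z := by rw [hv, h, one_smul]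
        rw [this, add_sub_cancel, hPg]; simp
      · rw [hPg z'] at m2
        exact mul_nonneg ht0.le (nonneg_of_mul_nonneg_right m2 (by linarith))
    rw [hPg z] at m1 f1
    have f3 : t * (d * ‖z' - z‖) < (c / 2 * r) ^ 2 := by
      have : t * (d * ‖z' - z‖) = r * ‖z' - z‖ := by
        rw [← mul_assoc, div_mul_cancel₀ _ hd.ne']
      rw [this]
      nlinarith
    have f4 := mul_le_mul_of_nonneg_left hup ht0.le
    rw [e3] at f4
    nlinarith
  have hG := HasFDerivAt.of_local_left_inverse hcont hQ (Eventually.of_forall hPg)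
  refine ⟨_, (hG.sub (hasFDerivAt_id z)).congr_of_eventuallyEq (Eventually.of_forall fun y => ?_)⟩
  simp [hg]

end Subgradient

/-! ### Sup-convolutions of Lipschitz functions. -/

section SupConvolution

variable {E : Type*} [NormedAddCommGroup E]

/-- `u` is the sup-convolution of `w` with parameter `δ`, and the supremum defining `u x` is
attained at `ζ x`. -/
structure IsSupConvolution (δ : ℝ) (w u : E → ℝ) (ζ : E → E) : Prop where
  eq : ∀ x, u x = w (ζ x) - ‖x - ζ x‖ ^ 2 / (2 * δ)
  le : ∀ x z, w z - ‖x - z‖ ^ 2 / (2 * δ) ≤ u x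

lemma LipschitzWith.exists_isSupConvolution [ProperSpace E] {L : NNReal} {w : E → ℝ}
    (hw : LipschitzWith L w) {δ : ℝ} (hδ : 0 < δ) : ∃ u ζ, IsSupConvolution δ w u ζ := by
  have hc := hw.continuous
  have : ∀ x, ∃ z, ∀ z', ‖x - z‖ ^ 2 / (2 * δ) - w z ≤ ‖x - z'‖ ^ 2 / (2 * δ) - w z' := fun x =>
    exists_forall_le_of_quadratic_growth (F := fun z => ‖x - z‖ ^ 2 / (2 * δ) - w z)
      (a := 1 / (2 * δ)) (b := L) (c := w x) (by fun_prop) x (by positivity) fun z => by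
        have h1 := (abs_le.1 (Real.dist_eq _ _ ▸ hw.dist_le_mul z x)).2
        rw [dist_eq_norm] at h1
        rw [norm_sub_rev x z, div_eq_mul_one_div (_ ^ 2)]
        linarith
  choose ζ hζ using this
  exact ⟨fun x => w (ζ x) - ‖x - ζ x‖ ^ 2 / (2 * δ), ζ, fun x => rfl, fun x z => by
    have := hζ x z
    linarith⟩

namespace IsSupConvolution

variable {δ : ℝ} {w u : E → ℝ} {ζ : E → E} {L : NNReal}

lemma self_le (h : IsSupConvolution δ w u ζ) (x : E) : w x ≤ u x := by
  simpa using h.le x x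

lemma le_add (h : IsSupConvolution δ w u ζ) (hw : LipschitzWith L w) (hδ : 0 < δ) (x : E) :
    u x ≤ w x + (L : ℝ) ^ 2 * δ / 2 := by
  have h1 := (abs_le.1 (Real.dist_eq _ _ ▸ hw.dist_le_mul (ζ x) x)).2
  rw [dist_eq_norm, norm_sub_rev] at h1
  have h2 : (L : ℝ) * ‖x - ζ x‖ - ‖x - ζ x‖ ^ 2 / (2 * δ) ≤ (L : ℝ) ^ 2 * δ / 2 := by
    rw [sub_le_iff_le_add, ← sub_le_iff_le_add', le_div_iff₀ (by positivity)]
    nlinarith [sq_nonneg (‖x - ζ x‖ - L * δ)]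
  rw [h.eq]
  linarith

/-- Since `u x ≥ w x`, the penalty at the maximizer cannot exceed the gain `L ‖x - ζ x‖`. This
bounds both the displacement and the momentum `(ζ x - x)/δ`. -/
lemma norm_sub_le (h : IsSupConvolution δ w u ζ) (hw : LipschitzWith L w) (hδ : 0 < δ) (x : E) :
    ‖x - ζ x‖ ≤ 2 * L * δ := by
  have h0 := h.self_le x
  rw [h.eq] at h0
  have h1 := (abs_le.1 (Real.dist_eq _ _ ▸ hw.dist_le_mul (ζ x) x)).2
  rw [dist_eq_norm, norm_sub_rev] at h1
  have h2 : ‖x - ζ x‖ ^ 2 / (2 * δ) ≤ L * ‖x - ζ x‖ := by linarith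
  rw [div_le_iff₀ (by positivity)] at h2
  rcases (norm_nonneg (x - ζ x)).eq_or_lt with h3 | h3
  · rw [← h3]; positivity
  · nlinarith

/-- Translating the maximizer along with the point keeps the penalty unchanged, so the constant of
`w` is inherited. -/
lemma lipschitzWith (h : IsSupConvolution δ w u ζ) (hw : LipschitzWith L w) :
    LipschitzWith L u := by
  refine LipschitzWith.of_le_add_mul L fun x y => ?_
  have h1 := h.le y (ζ x + (y - x))
  have h2 := (abs_le.1 (Real.dist_eq _ _ ▸ hw.dist_le_mul (ζ x) (ζ x + (y - x)))).2
  have e1 : y - (ζ x + (y - x)) = x - ζ x := by abel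
  have e2 : ζ x - (ζ x + (y - x)) = x - y := by abel
  rw [dist_eq_norm, e2, ← dist_eq_norm] at h2
  rw [e1] at h1
  rw [h.eq x]
  linarith

/-- Expanding the square turns `u + ‖·‖²/(2δ)` into a supremum of affine functions with slopes `δ⁻¹
• z`; the one attaining the supremum supports it. -/
lemma isSubgradient {E : Type*} [NormedAddCommGroup E] [InnerProductSpace ℝ E]
    {w u : E → ℝ} {ζ : E → E} (h : IsSupConvolution δ w u ζ) (hδ : 0 < δ) (x : E) :
    IsSubgradient (fun x => u x + ‖x‖ ^ 2 / (2 * δ)) x (δ⁻¹ • ζ x) := by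
  intro y
  have h1 := h.le y (ζ x)
  simp only
  rw [h.eq x]
  rw [norm_sub_sq_real] at h1 ⊢
  rw [real_inner_smul_left, inner_sub_right, real_inner_comm y, real_inner_comm x]
  have : δ⁻¹ * (⟪y, ζ x⟫_ℝ - ⟪x, ζ x⟫_ℝ)
    = (2 * ⟪y, ζ x⟫_ℝ) / (2 * δ) - (2 * ⟪x, ζ x⟫_ℝ) / (2 * δ) := by
    field_simp
  rw [this]
  simp only [add_div, sub_div] at h1 ⊢
  linarith

lemma add_right_eq (h : IsSupConvolution δ w u ζ) {k : E} (hk : ∀ x, w (x + k) = w x)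
    (x : E) : u (x + k) = u x := by
  apply le_antisymm
  · have h1 := h.le x (ζ (x + k) - k)
    have h2 := hk (ζ (x + k) - k)
    rw [sub_add_cancel] at h2
    have e : x - (ζ (x + k) - k) = x + k - ζ (x + k) := by abel
    rw [e, ← h2] at h1
    rw [h.eq (x + k)]
    exact h1
  · have h1 := h.le (x + k) (ζ x + k)
    rw [hk, add_sub_add_right_eq_sub] at h1
    rw [h.eq x]
    exact h1

end IsSupConvolution

end SupConvolution

/-! ### Quadratic forms, second moments and Glaeser's inequality. -/

section Matrices

variable {n : ℕ}

/-- The quadratic form `v ↦ vᵀ A v`. -/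
noncomputable def quadForm (A : Matrix (Fin n) (Fin n) ℝ) (v : RSpace n) : ℝ :=
  ∑ i, ∑ j, A i j * v i * v j

lemma quadForm_eq_dotProduct (A : Matrix (Fin n) (Fin n) ℝ) (v : RSpace n) :
    quadForm A v = v.ofLp ⬝ᵥ A.mulVec v.ofLp := by
  simp only [quadForm, dotProduct, Matrix.mulVec, Finset.mul_sum]
  exact Finset.sum_congr rfl fun i _ => Finset.sum_congr rfl fun j _ => by ring

lemma quadForm_nonneg {A : Matrix (Fin n) (Fin n) ℝ} (hA : A.PosSemidef) (v : RSpace n) :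
    0 ≤ quadForm A v := by
  rw [quadForm_eq_dotProduct]
  simpa using (Matrix.posSemidef_iff_dotProduct_mulVec.1 hA).2 v.ofLp

lemma quadForm_sub (A B : Matrix (Fin n) (Fin n) ℝ) (v : RSpace n) :
    quadForm (A - B) v = quadForm A v - quadForm B v := by
  simp only [quadForm, Matrix.sub_apply, sub_mul, Finset.sum_sub_distrib]

lemma abs_quadForm_le {A : Matrix (Fin n) (Fin n) ℝ} {c : ℝ} (h : ∀ i j, |A i j| ≤ c)
    (v : RSpace n) : |quadForm A v| ≤ n ^ 2 * c * ‖v‖ ^ 2 := by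
  have hv : ∀ i, |v i| ≤ ‖v‖ := fun i => by simpa using PiLp.norm_apply_le v i
  calc |quadForm A v| ≤ ∑ i : Fin n, ∑ j : Fin n, c * ‖v‖ ^ 2 := by
        refine (Finset.abs_sum_le_sum_abs _ _).trans (Finset.sum_le_sum fun i _ => ?_)
        refine (Finset.abs_sum_le_sum_abs _ _).trans (Finset.sum_le_sum fun j _ => ?_)
        rw [abs_mul, abs_mul, mul_assoc, sq]
        exact mul_le_mul (h i j) (mul_le_mul (hv i) (hv j) (abs_nonneg _) (norm_nonneg _))
          (by positivity) ((abs_nonneg _).trans (h i j))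
    _ = _ := by simp; ring

lemma inner_eq_sum_mul (u v : RSpace n) : ⟪u, v⟫_ℝ = ∑ i, u i * v i := by
  simp [PiLp.inner_apply, mul_comm]

/-- A sum of values of a bilinear form depends only on the second moment matrix. -/
lemma sum_bilin_eq {ι : Type*} [Fintype ι] {τ : ι → RSpace n} {M : Matrix (Fin n) (Fin n) ℝ}
    (hM : ∀ a b, M a b = ∑ i, τ i a * τ i b) (T : RSpace n →ₗ[ℝ] RSpace n →ₗ[ℝ] ℝ) :
    ∑ i, T (τ i) (τ i) =
      ∑ a, ∑ b, M a b * T (EuclideanSpace.single a 1) (EuclideanSpace.single b 1) := by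
  have hexp : ∀ v : RSpace n, v = ∑ a, v a • EuclideanSpace.single a (1 : ℝ) := fun v => by
    simpa using ((EuclideanSpace.basisFun (Fin n) ℝ).sum_repr v).symm
  have h1 : ∀ v : RSpace n, T v v =
      ∑ a, ∑ b, v a * v b * T (EuclideanSpace.single a 1) (EuclideanSpace.single b 1) := by
    intro v
    conv_lhs => rw [hexp v]
    simp only [map_sum, LinearMap.sum_apply, map_smul, LinearMap.smul_apply, smul_eq_mul,
      Finset.mul_sum]
    rw [Finset.sum_comm]
    exact Finset.sum_congr rfl fun i _ => Finset.sum_congr rfl fun j _ => by ring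
  simp only [h1, hM, Finset.sum_mul]
  rw [Finset.sum_comm]
  refine Finset.sum_congr rfl fun a _ => ?_
  rw [Finset.sum_comm]

lemma sum_inner_sq_eq_quadForm {ι : Type*} [Fintype ι] {τ : ι → RSpace n}
    {M : Matrix (Fin n) (Fin n) ℝ} (hM : ∀ a b, M a b = ∑ i, τ i a * τ i b) (v : RSpace n) :
    ∑ i, ⟪τ i, v⟫_ℝ ^ 2 = quadForm M v := by
  simp only [inner_eq_sum_mul, quadForm, hM, Finset.sum_mul, sq, Finset.mul_sum]
  rw [Finset.sum_comm]
  refine Finset.sum_congr rfl fun a _ => ?_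
  rw [Finset.sum_comm]
  refine Finset.sum_congr rfl fun b _ => Finset.sum_congr rfl fun c _ => by ring

/-- A positive semidefinite matrix is the second moment matrix of a finite family. -/
lemma Matrix.PosSemidef.exists_eq_sum {M : Matrix (Fin n) (Fin n) ℝ} (hM : M.PosSemidef) :
    ∃ (m : ℕ) (r : Fin m → RSpace n), ∀ a b, M a b = ∑ i, r i a * r i b := by
  obtain ⟨m, v, hv⟩ := Matrix.posSemidef_iff_eq_sum_vecMulVec.1 hM
  refine ⟨m, fun i => WithLp.toLp 2 (v i), fun a b => ?_⟩
  rw [hv]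
  simp [Matrix.sum_apply, Matrix.vecMulVec_apply]

/-- Monotonicity of `τ ↦ ∑ T(τᵢ, τᵢ)` in the second moments, for a nonnegative form `T`. -/
lemma sum_bilin_le {ι κ : Type*} [Fintype ι] [Fintype κ] {τ : ι → RSpace n} {r : κ → RSpace n}
    (h : ∀ v, ∑ i, ⟪τ i, v⟫_ℝ ^ 2 ≤ ∑ k, ⟪r k, v⟫_ℝ ^ 2) (T : RSpace n →ₗ[ℝ] RSpace n →ₗ[ℝ] ℝ)
    (hT : ∀ v, 0 ≤ T v v) : ∑ i, T (τ i) (τ i) ≤ ∑ k, T (r k) (r k) := by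
  set M : Matrix (Fin n) (Fin n) ℝ := fun a b => ∑ i, τ i a * τ i b with hM
  set R : Matrix (Fin n) (Fin n) ℝ := fun a b => ∑ i, r i a * r i b with hR
  have hD : (R - M).PosSemidef := by
    rw [Matrix.posSemidef_iff_dotProduct_mulVec]
    refine ⟨Matrix.IsHermitian.ext fun i j => ?_, fun x => ?_⟩
    · simp only [Matrix.sub_apply, star_trivial]
      simp only [hM, hR, mul_comm]
    · have := quadForm_eq_dotProduct (R - M) (WithLp.toLp 2 x)
      simp only [star_trivial]
      rw [← this, quadForm_sub, ← sum_inner_sq_eq_quadForm (τ := τ) (fun _ _ => rfl),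
        ← sum_inner_sq_eq_quadForm (τ := r) (fun _ _ => rfl)]
      linarith [h (WithLp.toLp 2 x)]
  -- The difference of the second moment matrices is itself a sum of squares, on which `T`
  -- contributes nonnegatively.
  obtain ⟨m, d, hd⟩ := hD.exists_eq_sum
  have h1 := sum_bilin_eq hd T
  have h2 : 0 ≤ ∑ i, T (d i) (d i) := Finset.sum_nonneg fun i _ => hT _
  rw [sum_bilin_eq (τ := τ) (M := M) (fun _ _ => rfl),
    sum_bilin_eq (τ := r) (M := R) (fun _ _ => rfl)]
  rw [h1] at h2
  simp only [Matrix.sub_apply, sub_mul, Finset.sum_sub_distrib] at h2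
  linarith

/-- Glaeser's inequality for families of positive semidefinite matrices. -/
lemma exists_glaeser_bound {A : RSpace n → Matrix (Fin n) (Fin n) ℝ}
    (hA : ∀ x, (A x).PosSemidef) {c : ℝ} (hc : 0 ≤ c)
    (l : RSpace n → Fin n → Fin n → RSpace n →L[ℝ] ℝ)
    (h : ∀ x v i j, |A (x + v) i j - A x i j - l x i j v| ≤ c * ‖v‖ ^ 2) :
    ∃ G, 0 ≤ G ∧ ∀ x y v, |quadForm (A y - A x) v| ≤
      G * (‖y - x‖ * √(quadForm (A x) v) * ‖v‖ + ‖y - x‖ ^ 2 * ‖v‖ ^ 2) := by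
  set m := (n : ℝ) ^ 2 * c with hm
  have hm0 : 0 ≤ m := by positivity
  refine ⟨2 * √m + m, by positivity, fun x y v => ?_⟩
  set d := y - x with hd
  set q := quadForm (A x) v with hq
  have hq0 : 0 ≤ q := quadForm_nonneg (hA x) v
  set b := quadForm (fun i j => l x i j d) v with hb
  have key : ∀ t : ℝ, |quadForm (A (x + t • d)) v - q - t * b| ≤ m * ‖v‖ ^ 2 * ‖d‖ ^ 2 * t ^ 2 := by
    intro t
    have h1 := abs_quadForm_le (A := fun i j => A (x + t • d) i j - A x i j - l x i j (t • d))
      (c := c * ‖t • d‖ ^ 2) (fun i j => h x (t • d) i j) v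
    have e : quadForm (fun i j => A (x + t • d) i j - A x i j - l x i j (t • d)) v
        = quadForm (A (x + t • d)) v - q - t * b := by
      simp only [hq, hb, quadForm, sub_mul, Finset.sum_sub_distrib, map_smul, smul_eq_mul,
        Finset.mul_sum, mul_assoc]
    rw [e, norm_smul, mul_pow, Real.norm_eq_abs, sq_abs] at h1
    refine h1.trans (le_of_eq (by rw [hm]; ring))
  -- Along the line through `x` and `y` the form is nonnegative and lies below a quadratic
  -- polynomial in `t`, whose discriminant is therefore nonpositive. This controls the linear
  -- coefficient `b` by `√q`.
  have disc : discrim (m * ‖v‖ ^ 2 * ‖d‖ ^ 2) b q ≤ 0 := discrim_le_zero fun t => by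
    have h1 := (abs_le.1 (key t)).2
    have h2 := quadForm_nonneg (hA (x + t • d)) v
    nlinarith
  have hb2 : |b| ≤ 2 * √m * (‖d‖ * √q * ‖v‖) := by
    apply abs_le_of_sq_le_sq _ (by positivity)
    rw [discrim] at disc
    have e : (2 * √m * (‖d‖ * √q * ‖v‖)) ^ 2 = 4 * (√m ^ 2) * (‖d‖ ^ 2 * √q ^ 2 * ‖v‖ ^ 2) := by
      ring
    rw [e, Real.sq_sqrt hm0, Real.sq_sqrt hq0]
    linarith
  have k1 := key 1
  rw [one_smul, hd, add_sub_cancel, ← hd, one_mul, one_pow, mul_one] at k1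
  rw [quadForm_sub, ← hq]
  have h3 := abs_add_le (quadForm (A y) v - q - b) b
  rw [sub_add_cancel] at h3
  have h4 : 0 ≤ 2 * √m * (‖d‖ ^ 2 * ‖v‖ ^ 2) := by positivity
  have h5 : 0 ≤ m * (‖d‖ * √q * ‖v‖) := by positivity
  nlinarith

end Matrices

/-! ### Perturbation of matrix square roots. -/

section Perturbation

variable {n : ℕ}

/-- The bilinear form `(u, v) ↦ uᵀ A v`. -/
noncomputable def matrixBilin (A : Matrix (Fin n) (Fin n) ℝ) :
    RSpace n →ₗ[ℝ] RSpace n →ₗ[ℝ] ℝ :=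
  LinearMap.mk₂ ℝ (fun u v => ∑ i, ∑ j, A i j * u i * v j)
    (fun u u' v => by simp [mul_add, add_mul, Finset.sum_add_distrib])
    (fun c u v => by
      simp only [Finset.mul_sum, PiLp.smul_apply, smul_eq_mul]
      exact Finset.sum_congr rfl fun i _ => Finset.sum_congr rfl fun j _ => by ring)
    (fun u v v' => by simp [mul_add, Finset.sum_add_distrib])
    (fun c u v => by
      simp only [Finset.mul_sum, PiLp.smul_apply, smul_eq_mul]
      exact Finset.sum_congr rfl fun i _ => Finset.sum_congr rfl fun j _ => by ring)

lemma matrixBilin_self (A : Matrix (Fin n) (Fin n) ℝ) (v : RSpace n) :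
    matrixBilin A v v = quadForm A v := rfl

lemma matrixBilin_comm {A : Matrix (Fin n) (Fin n) ℝ} (hA : ∀ i j, A i j = A j i)
    (u v : RSpace n) : matrixBilin A u v = matrixBilin A v u := by
  simp only [matrixBilin, LinearMap.mk₂_apply]
  rw [Finset.sum_comm]
  exact Finset.sum_congr rfl fun i _ => Finset.sum_congr rfl fun j _ => by rw [hA]; ring

lemma quadForm_add_add_quadForm_sub (A : Matrix (Fin n) (Fin n) ℝ) (u v : RSpace n) :
    quadForm A (u + v) + quadForm A (u - v) = 2 * quadForm A u + 2 * quadForm A v := by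
  simp only [← matrixBilin_self, map_add, map_sub, LinearMap.add_apply, LinearMap.sub_apply]
  ring

lemma quadForm_add_sub_quadForm_sub {A : Matrix (Fin n) (Fin n) ℝ} (hA : ∀ i j, A i j = A j i)
    (u v : RSpace n) : quadForm A (u + v) - quadForm A (u - v) = 4 * matrixBilin A u v := by
  simp only [← matrixBilin_self, map_add, map_sub, LinearMap.add_apply, LinearMap.sub_apply]
  rw [matrixBilin_comm hA v u]
  ring

/-- Diagonalization of a positive semidefinite real matrix. -/
lemma Matrix.PosSemidef.exists_diagonalization {A : Matrix (Fin n) (Fin n) ℝ}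
    (hA : A.PosSemidef) : ∃ (b : OrthonormalBasis (Fin n) ℝ (RSpace n)) (a : Fin n → ℝ),
      (∀ i, 0 ≤ a i) ∧ ∀ r s, A r s = ∑ i, a i * b i r * b i s := by
  refine ⟨hA.1.eigenvectorBasis, hA.1.eigenvalues, fun i => hA.eigenvalues_nonneg i,
    fun r s => ?_⟩
  set b := hA.1.eigenvectorBasis with hb
  have h1 : (Pi.single s (1 : ℝ) : Fin n → ℝ) = ∑ i, b i s • (b i).ofLp := by
    have h := (b.sum_repr (EuclideanSpace.single s (1 : ℝ))).symm
    have h2 : ∀ i, b.repr (EuclideanSpace.single s (1 : ℝ)) i = b i s := fun i => by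
      rw [b.repr_apply_apply, inner_eq_sum_mul]
      simp
    simp only [h2] at h
    simpa using congrArg WithLp.ofLp h
  have h3 : A r s = A.mulVec (Pi.single s (1 : ℝ)) r := by simp
  rw [h3, h1]
  simp only [Matrix.mulVec_sum, Matrix.mulVec_smul]
  rw [Finset.sum_apply]
  refine Finset.sum_congr rfl fun i _ => ?_
  have h4 := hA.1.mulVec_eigenvectorBasis i
  rw [← hb] at h4
  rw [h4]
  simp only [Pi.smul_apply, smul_eq_mul]
  ring

/-- Square roots of `A + θ²` and `B + θ²` differ by `O(θ)` if `B - A` satisfies Glaeser's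
inequality at scale `θ`, up to an error of order `θ²` in `B + θ²`. -/
lemma exists_sqrt_perturbation {A B : Matrix (Fin n) (Fin n) ℝ} (hA : A.PosSemidef)
    (hB : B.PosSemidef) {G θ : ℝ} (hG : 0 ≤ G) (hθ : 0 < θ)
    (h : ∀ v, |quadForm (B - A) v| ≤ G * (θ * √(quadForm A v) * ‖v‖ + θ ^ 2 * ‖v‖ ^ 2)) :
    ∃ (b : OrthonormalBasis (Fin n) ℝ (RSpace n)) (a : Fin n → ℝ) (k : Fin n → RSpace n),
      (∀ i, 0 ≤ a i) ∧ (∀ r s, A r s = ∑ i, a i * b i r * b i s) ∧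
      (∀ i, ‖k i‖ ≤ n * (3 * G * θ)) ∧
      ∀ v, ∑ i, ⟪√(a i + θ ^ 2) • b i + k i, v⟫_ℝ ^ 2 =
        quadForm B v + θ ^ 2 * ‖v‖ ^ 2 + ∑ i, ⟪k i, v⟫_ℝ ^ 2 := by
  obtain ⟨b, a, ha, hab⟩ := hA.exists_diagonalization
  set σ : Fin n → ℝ := fun i => √(a i + θ ^ 2) with hσ
  have hσsq : ∀ i, σ i ^ 2 = a i + θ ^ 2 := fun i =>
    Real.sq_sqrt (add_nonneg (ha i) (sq_nonneg θ))
  have hσθ : ∀ i, θ ≤ σ i := fun i => Real.le_sqrt_of_sq_le (by linarith [ha i])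
  have hσpos : ∀ i, 0 < σ i := fun i => hθ.trans_le (hσθ i)
  have hsymm : ∀ i j, (B - A) i j = (B - A) j i := fun i j => by
    have := (hB.1.sub hA.1).apply j i
    simpa using this
  have hquadA : ∀ v, quadForm A v = ∑ i, a i * ⟪b i, v⟫_ℝ ^ 2 := by
    intro v
    have := sum_inner_sq_eq_quadForm (τ := fun i => √(a i) • b i) (M := A) (fun r s => by
      rw [hab]
      refine Finset.sum_congr rfl fun i _ => ?_
      simp only [PiLp.smul_apply, smul_eq_mul]
      linear_combination (-(b i r * b i s)) * Real.mul_self_sqrt (ha i)) v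
    rw [← this]
    refine Finset.sum_congr rfl fun i _ => ?_
    rw [real_inner_smul_left, mul_pow, Real.sq_sqrt (ha i)]
  have hAb : ∀ i, quadForm A (b i) = a i := by
    intro i
    rw [hquadA, Finset.sum_eq_single i]
    · simp
    · intro j _ hj
      simp [b.inner_eq_zero hj]
    · simp
  -- This is applied to `v = b i ± b j`, where the parallelogram law gives the hypothesis. The `θ²`
  -- term is absorbed by `θ ≤ σ i`, and polarization then yields the entry bound `3Gθ(σ i + σ j)`.
  have hbnd : ∀ i j v, quadForm A v ≤ 2 * (a i + a j) → ‖v‖ ≤ 2 →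
      |quadForm (B - A) v| ≤ 6 * G * θ * (σ i + σ j) := by
    intro i j v hv hv2
    have h1 : √(quadForm A v) ≤ 2 * (σ i + σ j) := by
      refine Real.sqrt_le_iff.2 ⟨by linarith [hσpos i, hσpos j], ?_⟩
      nlinarith [hσsq i, hσsq j, mul_pos (hσpos i) (hσpos j), sq_nonneg θ, ha i, ha j]
    have h2 : √(quadForm A v) * ‖v‖ ≤ 2 * (σ i + σ j) * 2 :=
      mul_le_mul h1 hv2 (norm_nonneg _) (by linarith [hσpos i, hσpos j])
    have h3 : θ ^ 2 * ‖v‖ ^ 2 ≤ θ * (2 * (σ i + σ j)) := by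
      have : ‖v‖ ^ 2 ≤ 4 := by nlinarith [norm_nonneg v]
      nlinarith [hσθ i, hσθ j]
    refine (h v).trans ?_
    have : θ * √(quadForm A v) * ‖v‖ + θ ^ 2 * ‖v‖ ^ 2 ≤ 6 * θ * (σ i + σ j) := by
      nlinarith
    nlinarith
  have hT : ∀ i j, |matrixBilin (B - A) (b i) (b j)| ≤ 3 * G * θ * (σ i + σ j) := by
    intro i j
    have h1 := quadForm_add_sub_quadForm_sub hsymm (b i) (b j)
    have h2 := quadForm_add_add_quadForm_sub A (b i) (b j)
    rw [hAb, hAb] at h2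
    have p1 := quadForm_nonneg hA (b i + b j)
    have p2 := quadForm_nonneg hA (b i - b j)
    have n1 : ‖b i + b j‖ ≤ 2 := (norm_add_le _ _).trans (by simp; norm_num)
    have n2 : ‖b i - b j‖ ≤ 2 := (norm_sub_le _ _).trans (by simp; norm_num)
    have h3 := abs_le.1 (hbnd i j _ (by linarith) n1)
    have h4 := abs_le.1 (hbnd i j _ (by linarith) n2)
    exact abs_le.2 ⟨by linarith, by linarith⟩
  -- `K` solves the linearized square root equation `σK + Kσ = B - A` in the eigenbasis of `A`, so
  -- `(σ + K)² = B + θ² + K²`. Glaeser's bound makes the numerator `O(θ (σ i + σ j))`, so the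
  -- entries are `O(θ)` even where `A` degenerates.
  set K : Fin n → Fin n → ℝ := fun i j => matrixBilin (B - A) (b i) (b j) / (σ i + σ j) with hK
  have hKb : ∀ i j, |K i j| ≤ 3 * G * θ := by
    intro i j
    have hp : 0 < σ i + σ j := add_pos (hσpos i) (hσpos j)
    rw [hK, abs_div, abs_of_pos hp, div_le_iff₀ hp]
    exact hT i j
  refine ⟨b, a, fun i => ∑ j, K i j • b j, ha, hab, fun i => ?_, fun v => ?_⟩
  · calc ‖∑ j, K i j • b j‖ ≤ ∑ j : Fin n, 3 * G * θ := by
          refine (norm_sum_le _ _).trans (Finset.sum_le_sum fun j _ => ?_)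
          rw [norm_smul, b.norm_eq_one, mul_one]
          exact hKb i j
      _ = _ := by simp
  · set c : Fin n → ℝ := fun i => ⟪b i, v⟫_ℝ with hc
    have hk : ∀ i, ⟪∑ j, K i j • b j, v⟫_ℝ = ∑ j, K i j * c j := fun i => by
      simp only [sum_inner, real_inner_smul_left, hc]
    have hE : quadForm (B - A) v = ∑ i, ∑ j, c i * (c j * matrixBilin (B - A) (b i) (b j)) := by
      have hv : v = ∑ i, c i • b i := by
        conv_lhs => rw [← b.sum_repr v]
        exact Finset.sum_congr rfl fun i _ => by rw [b.repr_apply_apply]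
      rw [← matrixBilin_self]
      conv_lhs => rw [hv]
      simp only [map_sum, LinearMap.sum_apply, map_smul, LinearMap.smul_apply, smul_eq_mul,
        Finset.mul_sum]
      rw [Finset.sum_comm]
      exact Finset.sum_congr rfl fun i _ => Finset.sum_congr rfl fun j _ => by ring
    have hcross : 2 * ∑ i, σ i * c i * ∑ j, K i j * c j = quadForm (B - A) v := by
      have e1 : ∑ i, σ i * c i * ∑ j, K i j * c j = ∑ i, ∑ j, σ i * (c i * c j * K i j) := by
        simp only [Finset.mul_sum]
        exact Finset.sum_congr rfl fun i _ => Finset.sum_congr rfl fun j _ => by ring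
      have e2 : ∑ i, ∑ j, σ i * (c i * c j * K i j) = ∑ i, ∑ j, σ j * (c i * c j * K i j) := by
        rw [Finset.sum_comm]
        refine Finset.sum_congr rfl fun i _ => Finset.sum_congr rfl fun j _ => ?_
        have : K j i = K i j := by
          simp only [hK]; rw [matrixBilin_comm hsymm, add_comm]
        rw [this]; ring
      rw [two_mul, e1]
      nth_rewrite 2 [e2]
      rw [hE, ← Finset.sum_add_distrib]
      refine Finset.sum_congr rfl fun i _ => ?_
      rw [← Finset.sum_add_distrib]
      refine Finset.sum_congr rfl fun j _ => ?_
      have hp : σ i + σ j ≠ 0 := (add_pos (hσpos i) (hσpos j)).ne'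
      have : matrixBilin (B - A) (b i) (b j) = K i j * (σ i + σ j) := by
        rw [hK]; field_simp
      rw [this]; ring
    have hn : ‖v‖ ^ 2 = ∑ i, c i ^ 2 := by
      rw [← b.sum_sq_norm_inner_right v]
      simp [hc]
    have e3 : ∀ i, ⟪√(a i + θ ^ 2) • b i + ∑ j, K i j • b j, v⟫_ℝ ^ 2 =
        a i * c i ^ 2 + θ ^ 2 * c i ^ 2 + 2 * (σ i * c i * ∑ j, K i j * c j)
          + (∑ j, K i j * c j) ^ 2 := by
      intro i
      rw [inner_add_left, real_inner_smul_left, hk]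
      have := hσsq i
      linear_combination c i ^ 2 * this
    simp only [e3, hk, Finset.sum_add_distrib]
    rw [← Finset.mul_sum, ← Finset.mul_sum, hcross, quadForm_sub, ← hn, ← hquadA]
    ring

end Perturbation

/-! ### Uniform bounds from periodicity. -/

section Periodic

variable {n : ℕ}

/-- A jointly continuous function that is periodic in the first variable is bounded when the
second variable ranges over a compact set. -/
lemma ZPeriodic.exists_norm_le {P F : Type*} [TopologicalSpace P] [NormedAddCommGroup F]
    {f : RSpace n → P → F} (hf : ZPeriodic f) (hc : Continuous fun z : RSpace n × P => f z.1 z.2)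
    {S : Set P} (hS : IsCompact S) : ∃ C, 0 ≤ C ∧ ∀ x, ∀ p ∈ S, ‖f x p‖ ≤ C := by
  set Q : Set (RSpace n) := WithLp.toLp 2 '' (Set.univ.pi fun _ => Set.Icc (0 : ℝ) 1)
  have hQ : IsCompact Q :=
    (isCompact_univ_pi fun _ => isCompact_Icc).image (PiLp.continuous_toLp 2 _)
  obtain ⟨C, hC⟩ := (hQ.prod hS).exists_bound_of_continuousOn hc.continuousOn
  refine ⟨max C 0, le_max_right _ _, fun x p hp => ?_⟩
  have h1 := hf (fun i => -⌊x i⌋) x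
  rw [← h1]
  refine (hC (_, p) ⟨⟨fun i => Int.fract (x i), fun i _ => ⟨Int.fract_nonneg _,
    (Int.fract_lt_one _).le⟩, ?_⟩, hp⟩).trans (le_max_left _ _)
  ext i
  simp [Int.fract, sub_eq_add_neg]

lemma ZPeriodic.fderiv {F : Type*} [NormedAddCommGroup F] [NormedSpace ℝ F]
    {f : RSpace n → F} (hf : ZPeriodic f) : ZPeriodic (fderiv ℝ f) := by
  intro k x
  rw [← fderiv_comp_add_right]
  congr 1
  funext y
  exact hf k y

lemma ZPeriodic.exists_lipschitz {F : Type*} [NormedAddCommGroup F] [NormedSpace ℝ F]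
    {f : RSpace n → F} (hf : ZPeriodic f) (hc : ContDiff ℝ 1 f) :
    ∃ C, 0 ≤ C ∧ ∀ x y, ‖f y - f x‖ ≤ C * ‖y - x‖ := by
  have hp : ZPeriodic fun (x : RSpace n) (_ : Unit) => _root_.fderiv ℝ f x := fun k x => by
    funext u; exact hf.fderiv k x
  obtain ⟨C, hC0, hC⟩ := hp.exists_norm_le (S := Set.univ)
    ((hc.continuous_fderiv (by norm_num)).comp continuous_fst) isCompact_univ
  exact ⟨C, hC0, fun x y => convex_univ.norm_image_sub_le_of_norm_fderiv_le
    (fun z _ => hc.differentiable (by norm_num) z) (fun z _ => hC z () trivial) trivial trivial⟩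

lemma ZPeriodic.exists_quadratic_remainder {f : RSpace n → ℝ} (hf : ZPeriodic f)
    (hc : ContDiff ℝ 2 f) :
    ∃ C, 0 ≤ C ∧ ∀ x v, |f (x + v) - f x - _root_.fderiv ℝ f x v| ≤ C * ‖v‖ ^ 2 := by
  obtain ⟨C, hC0, hC⟩ := hf.fderiv.exists_lipschitz (hc.fderiv_right (by norm_num))
  refine ⟨C, hC0, fun x v => ?_⟩
  have := (convex_closedBall x ‖v‖).norm_image_sub_le_of_norm_fderiv_le' (f := f)
    (φ := _root_.fderiv ℝ f x) (C := C * ‖v‖) (x := x) (y := x + v)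
    (fun z _ => hc.differentiable (by norm_num) z)
    (fun z hz => (hC x z).trans (by
      have : ‖z - x‖ ≤ ‖v‖ := by simpa [dist_eq_norm] using hz
      gcongr)) (by simp) (by simp [dist_eq_norm])
  simpa [sq, mul_assoc] using this

/-- Periodicity bounds `H` for `‖p‖ ≤ R`, and the growth hypothesis turns this into a bound on
`D_xH`. It is used with `R = 2L`, the bound on the momenta of the sup-convolution. -/
lemma exists_lipschitz_of_gradient_growth {H : RSpace n → RSpace n → ℝ} (hH_per : ZPeriodic H)
    (hH : ContDiff ℝ 2 (fun z : RSpace n × RSpace n => H z.1 z.2))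
    (hH_growth : ∃ γ₁ : ℝ, 0 < γ₁ ∧
      ∀ x p, ‖gradient (fun y => H y p) x‖ ≤ γ₁ * (1 + |H x p|)) (R : ℝ) :
    ∃ C, 0 ≤ C ∧ ∀ x y p, ‖p‖ ≤ R → |H y p - H x p| ≤ C * ‖y - x‖ := by
  obtain ⟨γ, hγ, hg⟩ := hH_growth
  obtain ⟨C, hC0, hC⟩ := hH_per.exists_norm_le hH.continuous (isCompact_closedBall (0 : RSpace n) R)
  refine ⟨γ * (1 + C), by positivity, fun x y p hp => ?_⟩
  have hd : ContDiff ℝ 2 fun y => H y p := hH.comp (contDiff_id.prodMk contDiff_const)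
  refine convex_univ.norm_image_sub_le_of_norm_fderiv_le (𝕜 := ℝ) (f := fun y => H y p)
    (fun z _ => hd.differentiable (by norm_num) z) (fun z _ => ?_) trivial trivial
  have h1 : ‖_root_.fderiv ℝ (fun y => H y p) z‖ = ‖gradient (fun y => H y p) z‖ := by
    simp [gradient]
  rw [h1]
  refine (hg z p).trans ?_
  have := hC z p (by simpa using hp)
  rw [Real.norm_eq_abs] at this
  gcongr

end Periodic

/-! ### Quadratic test functions and the transported subsolution inequality. -/

section TestFunction

variable {n : ℕ}

/-- The trace sees `A x` only through its second moments, so any decomposition may be used: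
eigenvectors at `ζ y`, an arbitrary family at `x`. -/
lemma diffusionTerm_eq_sum {ι : Type*} [Fintype ι] {A : RSpace n → Matrix (Fin n) (Fin n) ℝ}
    {x : RSpace n} {τ : ι → RSpace n} (hτ : ∀ a b, A x a b = ∑ i, τ i a * τ i b)
    (φ : RSpace n → ℝ) :
    diffusionTerm A φ x = ∑ i, iteratedFDeriv ℝ 2 φ x ![τ i, τ i] := by
  have h := sum_bilin_eq hτ (bilinearIteratedFDerivTwo ℝ φ x)
  simp only [bilinearIteratedFDerivTwo_eq_iteratedFDeriv] at h
  rw [h, diffusionTerm, Matrix.trace]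
  simp only [Matrix.diag_apply, Matrix.mul_apply, hessianMatrix, Matrix.of_apply]
  rw [Finset.sum_comm]
  refine Finset.sum_congr rfl fun a _ => Finset.sum_congr rfl fun b _ => ?_
  have hs : A x a b = A x b a := by simp only [hτ, mul_comm]
  rw [hs]

/-- The quadratic function with gradient `p` and Hessian (the symmetric part of) `G` at `z`. -/
lemma quadratic_test_function {E : Type*} [NormedAddCommGroup E] [InnerProductSpace ℝ E]
    [CompleteSpace E] (z p : E) (G : E →L[ℝ] E) :
    ContDiff ℝ 2 (fun ξ => ⟪p, ξ - z⟫_ℝ + ⟪G (ξ - z), ξ - z⟫_ℝ / 2) ∧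
    gradient (fun ξ => ⟪p, ξ - z⟫_ℝ + ⟪G (ξ - z), ξ - z⟫_ℝ / 2) z = p ∧
    ∀ e, iteratedFDeriv ℝ 2 (fun ξ => ⟪p, ξ - z⟫_ℝ + ⟪G (ξ - z), ξ - z⟫_ℝ / 2) z ![e, e] =
      ⟪G e, e⟫_ℝ := by
  have hc : ContDiff ℝ 2 (fun ξ => ⟪p, ξ - z⟫_ℝ + ⟪G (ξ - z), ξ - z⟫_ℝ / 2) := by
    have h1 : ContDiff ℝ 2 fun ξ : E => ξ - z := contDiff_id.sub contDiff_const
    exact (contDiff_const.inner ℝ h1).add (((G.contDiff.comp h1).inner ℝ h1).div_const 2)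
  refine ⟨hc, HasGradientAt.gradient ?_, fun e => ?_⟩
  · rw [hasGradientAt_iff_isLittleO_nhds_zero]
    simp only [sub_self, map_zero, inner_zero_right, zero_div, add_zero, sub_zero,
      add_sub_cancel_left]
    refine Asymptotics.IsBigO.trans_isLittleO (g := fun h : E => ‖h‖ ^ 2) ?_ ?_
    · refine Asymptotics.IsBigO.of_bound ‖G‖ (Eventually.of_forall fun h => ?_)
      have h1 := abs_real_inner_le_norm (G h) h
      have h2 := G.le_opNorm h
      rw [Real.norm_eq_abs, abs_div, Real.norm_eq_abs, abs_of_nonneg (sq_nonneg ‖h‖), abs_two]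
      nlinarith [norm_nonneg h, abs_nonneg ⟪G h, h⟫_ℝ]
    · exact Asymptotics.isLittleO_norm_pow_id one_lt_two
  · have hq : ∀ (t : ℝ) (v : E), ⟪G (t • v), t • v⟫_ℝ = t ^ 2 * ⟪G v, v⟫_ℝ := fun t v => by
      rw [map_smul, real_inner_smul_left, real_inner_smul_right]; ring
    have hexp : (fun v => (fun ξ => ⟪p, ξ - z⟫_ℝ + ⟪G (ξ - z), ξ - z⟫_ℝ / 2) (z + v)
        - (fun ξ => ⟪p, ξ - z⟫_ℝ + ⟪G (ξ - z), ξ - z⟫_ℝ / 2) z - innerSL ℝ p v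
        - ⟪G v, v⟫_ℝ / 2) =o[𝓝 0] fun v => ‖v‖ ^ 2 := by
      refine (Asymptotics.isLittleO_zero _ _).congr_left fun v => ?_
      simp
    have := tendsto_second_difference_of_expansion
      (f := fun ξ => ⟪p, ξ - z⟫_ℝ + ⟪G (ξ - z), ξ - z⟫_ℝ / 2) (x := z) (l := innerSL ℝ p)
      (q := fun v => ⟪G v, v⟫_ℝ) hq hexp e
    exact tendsto_nhds_unique (hc.tendsto_second_difference z e) this

/-- The subsolution inequality for `w` at `ζ y`, in terms of the second order expansion of the
sup-convolution at `y`; the linear map `1 + N` transports displacements from `ζ y` to `y`. -/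
lemma IsViscositySubsolution.le_of_hasFDerivAt {H : RSpace n → RSpace n → ℝ}
    {A : RSpace n → Matrix (Fin n) (Fin n) ℝ} {c₀ : ℝ} {w u : RSpace n → ℝ}
    {ζ : RSpace n → RSpace n} (hsub : IsViscositySubsolution H A c₀ w) {δ : ℝ} (hδ : 0 < δ)
    (h : IsSupConvolution δ w u ζ) {y : RSpace n} {Y : RSpace n →L[ℝ] RSpace n}
    (hY : HasFDerivAt (fun x => δ⁻¹ • ζ x) Y y) (N : RSpace n →L[ℝ] RSpace n)
    {ι : Type*} [Fintype ι] {τ : ι → RSpace n} (hτ : ∀ a b, A (ζ y) a b = ∑ i, τ i a * τ i b) :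
    H (ζ y) (δ⁻¹ • (ζ y - y)) ≤ ∑ i, (⟪Y (τ i + N (τ i)), τ i + N (τ i)⟫_ℝ
      - δ⁻¹ * ‖τ i + N (τ i)‖ ^ 2 + δ⁻¹ * ‖N (τ i)‖ ^ 2) + c₀ := by
  set z := ζ y with hz
  set p := δ⁻¹ • (z - y) with hp
  set M : RSpace n →L[ℝ] RSpace n := 1 + N with hM
  have hMv : ∀ v, M v = v + N v := fun v => by simp [hM]
  -- Hessian of `v ↦ u (y + M v) + ‖(y - z) + N v‖²/(2δ)`, which touches `w (z + v)` from above at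
  -- `v = 0`; here `Y - δ⁻¹` is the Hessian of `u`. The extra `ε` absorbs the `o(‖v‖²)` error and is
  -- sent to zero at the end.
  set G : ℝ → RSpace n →L[ℝ] RSpace n := fun ε =>
    ContinuousLinearMap.adjoint M ∘L Y ∘L M - δ⁻¹ • (ContinuousLinearMap.adjoint M ∘L M)
      + δ⁻¹ • (ContinuousLinearMap.adjoint N ∘L N) + ε • 1 with hG
  have hGv : ∀ ε v, ⟪G ε v, v⟫_ℝ = ⟪Y (M v), M v⟫_ℝ - δ⁻¹ * ‖M v‖ ^ 2 + δ⁻¹ * ‖N v‖ ^ 2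
      + ε * ‖v‖ ^ 2 := by
    intro ε v
    simp [hG, inner_add_left, inner_sub_left, real_inner_smul_left,
      ContinuousLinearMap.adjoint_inner_left]
  have hexp := expansion_of_hasFDerivAt_subgradient (fun x => h.isSubgradient hδ x) hY
  have key : ∀ ε : ℝ, 0 < ε → H z p ≤ ∑ i, ⟪G ε (τ i), τ i⟫_ℝ + c₀ := by
    intro ε hε
    obtain ⟨t1, t2, t3⟩ := quadratic_test_function z p (G ε)
    have := hsub _ z t1 ?_
    · rw [t2, diffusionTerm_eq_sum hτ] at this
      simpa only [t3] using this
    · have e1 := hexp.def (show 0 < ε / (2 * (‖M‖ ^ 2 + 1)) by positivity)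
      have lim : Tendsto (fun ξ => M (ξ - z)) (𝓝 z) (𝓝 0) := by
        have : Continuous fun ξ => M (ξ - z) := by fun_prop
        simpa using this.tendsto z
      filter_upwards [lim.eventually e1] with ξ hξ
      set v := ξ - z with hv
      have hξv : ξ = z + v := by rw [hv]; abel
      have b1 : ‖M v‖ ^ 2 ≤ ‖M‖ ^ 2 * ‖v‖ ^ 2 := by
        rw [← mul_pow]; gcongr; exact M.le_opNorm v
      have b2 : ε / (2 * (‖M‖ ^ 2 + 1)) * ‖M v‖ ^ 2 ≤ ε / 2 * ‖v‖ ^ 2 := by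
        rw [div_mul_eq_mul_div, div_le_iff₀ (by positivity)]
        nlinarith [sq_nonneg ‖v‖]
      rw [Real.norm_eq_abs, Real.norm_eq_abs, abs_of_nonneg (sq_nonneg ‖M v‖)] at hξ
      have b3 := (abs_le.1 hξ).2.trans b2
      -- The point `ξ = z + v` is a competitor in the supremum defining `u (y + M v)`; at `v = 0` it
      -- is the maximizer.
      have b4 := h.le (y + M v) ξ
      have b5 := h.eq y
      rw [← hz] at b5 b3
      have b6 : y + M v - ξ = (y - z) + N v := by rw [hMv, hξv]; abel
      rw [b6] at b4
      simp only [sub_self, map_zero, inner_zero_right, zero_div, add_zero, sub_zero]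
      rw [hGv]
      have b7 : ⟪p, v⟫_ℝ = δ⁻¹ * ⟪z, M v⟫_ℝ - δ⁻¹ * ⟪y, M v⟫_ℝ + δ⁻¹ * ⟪y - z, N v⟫_ℝ := by
        rw [hp, real_inner_smul_left, hMv, inner_add_right, inner_add_right, inner_sub_left,
          inner_sub_left]
        ring
      rw [b7]
      rw [real_inner_smul_left] at b3
      have b8 := norm_add_sq_real y (M v)
      have b9 := norm_add_sq_real (y - z) (N v)
      have b10 : ∀ s : ℝ, s / (2 * δ) = δ⁻¹ * s / 2 := fun s => by field_simp
      simp only [b10, b8, b9] at b3 b4 b5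
      nlinarith
  have lim : Tendsto (fun ε : ℝ => ∑ i, ⟪G ε (τ i), τ i⟫_ℝ + c₀) (𝓝[>] 0)
      (𝓝 (∑ i, ⟪G 0 (τ i), τ i⟫_ℝ + c₀)) := by
    have : Continuous fun ε : ℝ => ∑ i, ⟪G ε (τ i), τ i⟫_ℝ + c₀ := by
      simp only [hGv]; fun_prop
    exact (this.tendsto 0).mono_left nhdsWithin_le_nhds
  have fin := ge_of_tendsto lim (by
    filter_upwards [self_mem_nhdsWithin] with ε hε using key ε hε)
  refine fin.trans (le_of_eq ?_)
  simp [hGv, hMv]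

end TestFunction

/-! ### The second order inequality for the sup-convolution. -/

section SecondOrder

variable {n : ℕ}

lemma IsSubgradient.second_difference_nonneg {E : Type*} [NormedAddCommGroup E]
    [InnerProductSpace ℝ E] {f : E → ℝ} {x p : E} (h : IsSubgradient f x p) (v : E) :
    0 ≤ f (x + v) + f (x - v) - 2 * f x := by
  have h1 := h (x + v)
  have h2 := h (x - v)
  have e : x - v - x = -v := by abel
  rw [add_sub_cancel_left] at h1
  rw [e, inner_neg_right] at h2
  linarith

lemma inner_nonneg_of_hasFDerivAt_subgradient {E : Type*} [NormedAddCommGroup E]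
    [InnerProductSpace ℝ E] {f : E → ℝ} {s : E → E} (hs : ∀ x, IsSubgradient f x (s x)) {x : E}
    {Y : E →L[ℝ] E} (hY : HasFDerivAt s Y x) (v : E) : 0 ≤ ⟪Y v, v⟫_ℝ := by
  have h1 := tendsto_second_difference_of_expansion (f := f) (x := x) (l := innerSL ℝ (s x))
    (q := fun v => ⟪Y v, v⟫_ℝ)
    (fun t v => by rw [map_smul, real_inner_smul_left, real_inner_smul_right]; ring)
    (expansion_of_hasFDerivAt_subgradient hs hY) v
  exact ge_of_tendsto' h1 fun h => div_nonneg ((hs x).second_difference_nonneg _) (sq_nonneg h)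

lemma sum_norm_sq_eq {ι : Type*} [Fintype ι] (τ : ι → RSpace n) :
    ∑ i, ‖τ i‖ ^ 2 = ∑ a : Fin n, ∑ i, ⟪τ i, EuclideanSpace.single a (1 : ℝ)⟫_ℝ ^ 2 := by
  rw [Finset.sum_comm]
  refine Finset.sum_congr rfl fun i _ => ?_
  rw [EuclideanSpace.norm_sq_eq]
  simp [inner_eq_sum_mul]

/-- The subsolution inequality for `w`, transferred to the sup-convolution at scale `η` and to the
uniformly elliptic matrix `A x + K η²` at a point `x` at distance at most `η²`. -/
lemma IsViscositySubsolution.le_sum_second_order {H : RSpace n → RSpace n → ℝ}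
    {A : RSpace n → Matrix (Fin n) (Fin n) ℝ} {c₀ : ℝ} {w u : RSpace n → ℝ}
    {ζ : RSpace n → RSpace n} (hsub : IsViscositySubsolution H A c₀ w)
    (hA : ∀ x, (A x).PosSemidef) {L : NNReal} (hw : LipschitzWith L w) {η : ℝ} (hη : 0 < η)
    (h : IsSupConvolution η w u ζ) {G : ℝ} (hG0 : 0 ≤ G)
    (hG : ∀ x y v, |quadForm (A y - A x) v| ≤
      G * (‖y - x‖ * √(quadForm (A x) v) * ‖v‖ + ‖y - x‖ ^ 2 * ‖v‖ ^ 2))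
    {a₁ : ℝ} (ha₁ : 0 ≤ a₁) (hA₁ : ∀ x y v, |quadForm (A y - A x) v| ≤ a₁ * ‖y - x‖ * ‖v‖ ^ 2)
    {κ K : ℝ} (hκ : κ = n * (3 * (G * (2 * L + (2 * L) ^ 2)))) (hK : a₁ + 1 + n * κ ^ 2 ≤ K)
    {x y : RSpace n} (hxy : ‖y - x‖ ≤ η ^ 2)
    {Y : RSpace n →L[ℝ] RSpace n} (hY : HasFDerivAt (fun x => η⁻¹ • ζ x) Y y)
    {m : ℕ} {r : Fin m → RSpace n}
    (hr : ∀ v, ∑ k, ⟪r k, v⟫_ℝ ^ 2 = quadForm (A x) v + K * η ^ 2 * ‖v‖ ^ 2) :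
    H (ζ y) (η⁻¹ • (ζ y - y)) ≤ ∑ k, (⟪Y (r k), r k⟫_ℝ - η⁻¹ * ‖r k‖ ^ 2) + c₀
      + (n * ((1 + κ) ^ 2 + κ ^ 2) + n * (a₁ + K)) * η := by
  set z := ζ y with hz
  set R : ℝ := 2 * L with hR
  have hR0 : 0 ≤ R := by positivity
  have hκ0 : 0 ≤ κ := by rw [hκ]; positivity
  have hyz : ‖y - z‖ ≤ R * η := h.norm_sub_le hw hη y
  have hYnn := inner_nonneg_of_hasFDerivAt_subgradient (fun x => h.isSubgradient hη x) hY
  obtain ⟨b, a, k, ha, hab, hk, hsum⟩ := exists_sqrt_perturbation (hA z) (hA y)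
    (G := G * (R + R ^ 2)) (by positivity) hη (fun v => by
      refine (hG z y v).trans ?_
      have h1 : ‖y - z‖ * (√(quadForm (A z) v) * ‖v‖) ≤ R * η * (√(quadForm (A z) v) * ‖v‖) := by
        gcongr
      have h2 : ‖y - z‖ ^ 2 * ‖v‖ ^ 2 ≤ (R * η) ^ 2 * ‖v‖ ^ 2 := by gcongr
      have h3 : 0 ≤ R ^ 2 * (η * √(quadForm (A z) v) * ‖v‖) := by positivity
      have h4 : 0 ≤ R * (η ^ 2 * ‖v‖ ^ 2) := by positivity
      rw [mul_assoc G]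
      refine mul_le_mul_of_nonneg_left ?_ hG0
      nlinarith)
  have hkκ : ∀ i, ‖k i‖ ≤ κ * η := fun i => (hk i).trans (le_of_eq (by rw [hκ]; ring))
  set σ : Fin n → ℝ := fun i => √(a i + η ^ 2) with hσ
  have hσsq : ∀ i, σ i ^ 2 = a i + η ^ 2 := fun i =>
    Real.sq_sqrt (add_nonneg (ha i) (sq_nonneg η))
  have hση : ∀ i, η ≤ σ i := fun i => Real.le_sqrt_of_sq_le (by linarith [ha i])
  have hσpos : ∀ i, 0 < σ i := fun i => hη.trans_le (hση i)
  -- `N` is chosen so that `(1 + N) (b i) = (σ i)⁻¹ • ρ i`, where the `ρ i` have second moments `A y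
  -- + η² + ∑ k kᵀ`. Dividing by `σ i ≥ η` is harmless because `‖k i‖ ≤ κη`.
  set N : RSpace n →L[ℝ] RSpace n :=
    ∑ i, (innerSL ℝ (b i)).smulRight ((σ i)⁻¹ • k i) with hN
  have hNb : ∀ i, N (b i) = (σ i)⁻¹ • k i := by
    intro i
    simp only [hN, _root_.sum_apply, ContinuousLinearMap.smulRight_apply,
      innerSL_apply_apply]
    rw [Finset.sum_eq_single i]
    · simp
    · intro j _ hj
      simp [b.inner_eq_zero hj]
    · simp
  set μ : Fin n → RSpace n := fun i => b i + (σ i)⁻¹ • k i with hμ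
  set ρ : Fin n → RSpace n := fun i => σ i • b i + k i with hρ
  have hρμ : ∀ i, ρ i = σ i • μ i := fun i => by
    simp only [hρ, hμ, smul_add, smul_smul]
    rw [mul_inv_cancel₀ (hσpos i).ne', one_smul]
  have hmain := hsub.le_of_hasFDerivAt hη h hY N (τ := fun i => √(a i) • b i) (fun s t => by
    rw [hab]
    refine Finset.sum_congr rfl fun i _ => ?_
    simp only [PiLp.smul_apply, smul_eq_mul]
    linear_combination (-(b i s * b i t)) * Real.mul_self_sqrt (ha i))
  -- Passing from weight `a i` to `a i + η²` only increases the `Y` term since `Y ≥ 0`, and changes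
  -- the `η⁻¹` term by at most `(1 + κ)² η`; the transport cost is at most `κ² η`.
  have hterm : ∀ i, ⟪Y (√(a i) • b i + N (√(a i) • b i)), √(a i) • b i + N (√(a i) • b i)⟫_ℝ
      - η⁻¹ * ‖√(a i) • b i + N (√(a i) • b i)‖ ^ 2 + η⁻¹ * ‖N (√(a i) • b i)‖ ^ 2
      ≤ ⟪Y (ρ i), ρ i⟫_ℝ - η⁻¹ * ‖ρ i‖ ^ 2 + ((1 + κ) ^ 2 + κ ^ 2) * η := by
    intro i
    have e1 : √(a i) • b i + N (√(a i) • b i) = √(a i) • μ i := by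
      rw [map_smul, hNb, hμ, smul_add]
    have hs : √(a i) ^ 2 = a i := Real.sq_sqrt (ha i)
    rw [e1, map_smul N, hNb, hρμ, map_smul, map_smul]
    simp only [real_inner_smul_left, real_inner_smul_right, norm_smul, mul_pow, Real.norm_eq_abs,
      sq_abs, hs, hσsq, abs_inv, inv_pow]
    have q1 : √(a i) * (√(a i) * ⟪Y (μ i), μ i⟫_ℝ) = a i * ⟪Y (μ i), μ i⟫_ℝ := by
      rw [← mul_assoc, ← sq, hs]
    have q2 : σ i * (σ i * ⟪Y (μ i), μ i⟫_ℝ) = (a i + η ^ 2) * ⟪Y (μ i), μ i⟫_ℝ := by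
      rw [← mul_assoc, ← sq, hσsq]
    rw [q1, q2]
    have i1 : ‖(σ i)⁻¹ • k i‖ ≤ κ := by
      rw [norm_smul, norm_inv, Real.norm_eq_abs, abs_of_pos (hσpos i),
        inv_mul_le_iff₀ (hσpos i)]
      nlinarith [hkκ i, hση i]
    have i2 : ‖μ i‖ ^ 2 ≤ (1 + κ) ^ 2 := by
      have : ‖μ i‖ ≤ 1 + κ := (norm_add_le _ _).trans (by rw [b.norm_eq_one]; linarith)
      gcongr
    have i3 : a i * ((a i + η ^ 2)⁻¹ * ‖k i‖ ^ 2) ≤ κ ^ 2 * η ^ 2 := by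
      have j1 : ‖k i‖ ^ 2 ≤ κ ^ 2 * η ^ 2 := by
        rw [← mul_pow]; gcongr; exact hkκ i
      have j2 : a i * (a i + η ^ 2)⁻¹ ≤ 1 := by
        rw [← div_eq_mul_inv, div_le_one (by have := ha i; positivity)]
        linarith [sq_nonneg η]
      calc a i * ((a i + η ^ 2)⁻¹ * ‖k i‖ ^ 2) = a i * (a i + η ^ 2)⁻¹ * ‖k i‖ ^ 2 := by ring
        _ ≤ 1 * ‖k i‖ ^ 2 := by gcongr
        _ ≤ _ := by linarith
    have i4 : η⁻¹ * (a i * ((a i + η ^ 2)⁻¹ * ‖k i‖ ^ 2)) ≤ κ ^ 2 * η := by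
      rw [inv_mul_le_iff₀ hη]
      linarith
    have i5 : η⁻¹ * ((a i + η ^ 2) * ‖μ i‖ ^ 2) = η⁻¹ * (a i * ‖μ i‖ ^ 2) + η * ‖μ i‖ ^ 2 := by
      field_simp
    have i6 := hYnn (μ i)
    have i7 : 0 ≤ η ^ 2 * ⟪Y (μ i), μ i⟫_ℝ := by positivity
    have i8 : η * ‖μ i‖ ^ 2 ≤ η * (1 + κ) ^ 2 := by gcongr
    rw [i5]
    linarith
  have hk2 : ∀ v, ∑ i, ⟪k i, v⟫_ℝ ^ 2 ≤ n * κ ^ 2 * η ^ 2 * ‖v‖ ^ 2 := by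
    intro v
    calc ∑ i, ⟪k i, v⟫_ℝ ^ 2 ≤ ∑ i : Fin n, (κ * η) ^ 2 * ‖v‖ ^ 2 := by
          refine Finset.sum_le_sum fun i _ => ?_
          rw [← mul_pow, ← sq_abs]
          have := abs_real_inner_le_norm (k i) v
          gcongr
          exact this.trans (by gcongr; exact hkκ i)
      _ = _ := by simp; ring
  have hAxy : ∀ v, |quadForm (A y) v - quadForm (A x) v| ≤ a₁ * η ^ 2 * ‖v‖ ^ 2 := by
    intro v
    rw [← quadForm_sub]
    refine (hA₁ x y v).trans ?_
    gcongr
  -- The three parts of `K` pay for `A y - A x` (`a₁`), the shift `η²` (`1`) and the quadratic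
  -- remainder `∑ k kᵀ` (`n κ²`).
  have hcmp : ∀ v, ∑ i, ⟪ρ i, v⟫_ℝ ^ 2 ≤ ∑ i, ⟪r i, v⟫_ℝ ^ 2 := by
    intro v
    rw [hr, hsum]
    have h1 := (abs_le.1 (hAxy v)).2
    have h2 := hk2 v
    have h3 := mul_le_mul_of_nonneg_right hK (by positivity : 0 ≤ η ^ 2 * ‖v‖ ^ 2)
    linarith
  have hYsum := sum_bilin_le hcmp ((innerₗ (RSpace n)).comp (Y : RSpace n →ₗ[ℝ] RSpace n)) hYnn
  -- Enlarging the matrix also enlarges the subtracted term `η⁻¹ ‖·‖²`; its excess must be `O(η²)`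
  -- to remain `O(η)` after division by `η`.
  have htr : ∑ i, ‖r i‖ ^ 2 ≤ ∑ i, ‖ρ i‖ ^ 2 + n * (a₁ + K) * η ^ 2 := by
    rw [sum_norm_sq_eq, sum_norm_sq_eq]
    have : (n : ℝ) * (a₁ + K) * η ^ 2 = ∑ _a : Fin n, (a₁ + K) * η ^ 2 := by simp; ring
    rw [this, ← Finset.sum_add_distrib]
    refine Finset.sum_le_sum fun a _ => ?_
    rw [hr, hsum]
    have h1 := (abs_le.1 (hAxy (EuclideanSpace.single a (1 : ℝ)))).1
    have h2 : 0 ≤ ∑ i, ⟪k i, EuclideanSpace.single a (1 : ℝ)⟫_ℝ ^ 2 :=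
      Finset.sum_nonneg fun i _ => sq_nonneg _
    have h3 : ‖EuclideanSpace.single a (1 : ℝ)‖ = 1 := by simp
    rw [h3] at h1 ⊢
    nlinarith [sq_nonneg η]
  have htr' : η⁻¹ * ∑ i, ‖r i‖ ^ 2 ≤ η⁻¹ * ∑ i, ‖ρ i‖ ^ 2 + n * (a₁ + K) * η := by
    refine (mul_le_mul_of_nonneg_left htr (inv_nonneg.2 hη.le)).trans (le_of_eq ?_)
    field_simp
  have hfin := Finset.sum_le_sum fun i (_ : i ∈ Finset.univ) => hterm i
  simp only [Finset.sum_add_distrib, Finset.sum_sub_distrib, ← Finset.mul_sum, Finset.sum_const,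
    Finset.card_univ, Fintype.card_fin, nsmul_eq_mul] at hfin hmain ⊢
  simp only [LinearMap.comp_apply, ContinuousLinearMap.coe_coe, innerₗ_apply_apply] at hYsum
  linarith

end SecondOrder

/-! ### From almost everywhere inequalities to the mollification. -/

section Mollification

/-- First difference quotients at a point with a second order expansion. -/
lemma tendsto_first_difference_of_expansion {E : Type*} [NormedAddCommGroup E]
    [NormedSpace ℝ E] {f : E → ℝ} {x : E} {l : E →L[ℝ] ℝ} {q : E → ℝ}
    (hq : ∀ (t : ℝ) v, q (t • v) = t ^ 2 * q v)
    (h : (fun v => f (x + v) - f x - l v - q v / 2) =o[𝓝 0] fun v => ‖v‖ ^ 2) (e : E) :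
    Tendsto (fun h : ℝ => (f (x + h • e) - f x) / h) (𝓝[≠] 0) (𝓝 (l e)) := by
  have h0 : Tendsto (fun t : ℝ => t • e) (𝓝[≠] 0) (𝓝 0) := by
    have : Continuous fun t : ℝ => t • e := by fun_prop
    simpa using (this.tendsto 0).mono_left nhdsWithin_le_nhds
  have h2 : ((fun v : E => ‖v‖ ^ 2) ∘ fun t : ℝ => t • e) =O[𝓝[≠] 0] fun t : ℝ => t ^ 2 := by
    refine Asymptotics.IsBigO.of_bound (‖e‖ ^ 2) (Eventually.of_forall fun t => ?_)
    simp [norm_smul, mul_pow, mul_comm]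
  have h3 : (fun t : ℝ => t ^ 2) =o[𝓝[≠] 0] fun t => t :=
    (Asymptotics.isLittleO_pow_id one_lt_two).mono nhdsWithin_le_nhds
  have k1 := (((h.comp_tendsto h0).trans_isBigO h2).trans h3).tendsto_div_nhds_zero
  have k2 : Tendsto (fun t : ℝ => l e + t * q e / 2) (𝓝[≠] 0) (𝓝 (l e)) := by
    have : Continuous fun t : ℝ => l e + t * q e / 2 := by fun_prop
    simpa using (this.tendsto 0).mono_left nhdsWithin_le_nhds
  have kk := k1.add k2
  rw [zero_add] at kk
  refine kk.congr' ?_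
  filter_upwards [self_mem_nhdsWithin] with t ht
  have ht' : t ≠ 0 := ht
  simp only [Function.comp, hq, map_smul, smul_eq_mul]
  field_simp
  ring

/-- The tangent plane inequality for a convex function. -/
lemma ConvexOn.add_inner_gradient_le {E : Type*} [NormedAddCommGroup E] [InnerProductSpace ℝ E]
    [CompleteSpace E] {f : E → ℝ} (hf : ConvexOn ℝ Set.univ f) {x : E}
    (hd : DifferentiableAt ℝ f x) : IsSubgradient f x (gradient f x) := by
  intro y
  have h1 : HasDerivAt (fun t : ℝ => f (x + t • (y - x))) ⟪gradient f x, y - x⟫_ℝ 0 := by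
    have := hd.hasGradientAt.hasFDerivAt.hasLineDerivAt (y - x)
    simpa [HasLineDerivAt] using this
  have h2 := (hasDerivAt_iff_tendsto_slope.1 h1).mono_left
    (nhdsGT_le_nhdsNE (0 : ℝ))
  have h3 : ⟪gradient f x, y - x⟫_ℝ ≤ f y - f x := by
    refine le_of_tendsto h2 ?_
    filter_upwards [Ioc_mem_nhdsGT (zero_lt_one' ℝ)] with t ht
    have := hf.2 (Set.mem_univ x) (Set.mem_univ y) (sub_nonneg.2 ht.2) ht.1.le (by ring)
    have e : (1 - t) • x + t • y = x + t • (y - x) := by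
      rw [sub_smul, smul_sub, one_smul]; abel
    rw [e] at this
    simp only [slope, smul_eq_mul, sub_zero, zero_smul, add_zero, vsub_eq_sub]
    rw [inv_mul_le_iff₀ ht.1]
    simp only [smul_eq_mul] at this
    linarith
  linarith

variable {n : ℕ}

/-- The second order difference quotient `∑ₖ δ²u(x; h rₖ) / h² - (u (x + h v) - u x) / h`. -/
noncomputable def differenceQuotient {m : ℕ} (r : Fin m → RSpace n) (v : RSpace n)
    (u : RSpace n → ℝ) (h : ℝ) (x : RSpace n) : ℝ :=
  ∑ k, (u (x + h • r k) + u (x - h • r k) - 2 * u x) / h ^ 2 - (u (x + h • v) - u x) / h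

/-- A lower bound for the limits of difference quotients almost everywhere passes to the
mollification, for a semiconvex Lipschitz function. -/
lemma le_of_ae_le_differenceQuotient {L : NNReal} {u : RSpace n → ℝ} (hu : LipschitzWith L u)
    {δ : ℝ} (hδ : 0 < δ) (hsc : ∀ y e, -(δ⁻¹ * ‖e‖ ^ 2) ≤ u (y + e) + u (y - e) - 2 * u y)
    (φ : ContDiffBump (0 : RSpace n)) {W : RSpace n → ℝ}
    (hW : ∀ x, W x = ∫ t, φ.normed volume t * u (x - t)) (hWc : ContDiff ℝ 2 W)
    {m : ℕ} (r : Fin m → RSpace n) (v x : RSpace n) {c : ℝ}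
    (hae : ∀ᵐ y, ‖y - x‖ < φ.rOut → ∃ l, c ≤ l ∧
      Tendsto (fun h => differenceQuotient r v u h y) (𝓝[>] 0) (𝓝 l)) :
    c ≤ ∑ k, iteratedFDeriv ℝ 2 W x ![r k, r k] - fderiv ℝ W x v := by
  set ψ := φ.normed (volume : Measure (RSpace n)) with hψ
  have hψc : Continuous ψ := φ.continuous_normed
  have hψs : HasCompactSupport ψ := φ.hasCompactSupport_normed
  have hψ0 : ∀ t, 0 ≤ ψ t := fun t => φ.nonneg_normed t
  have huc := hu.continuous
  have hint : ∀ g : RSpace n → ℝ, Continuous g → Integrable fun t => ψ t * g t := fun g hg =>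
    (hψc.mul hg).integrable_of_hasCompactSupport hψs.mul_right
  have hQc : ∀ h, Continuous fun t => differenceQuotient r v u h (x - t) := fun h => by
    unfold differenceQuotient; fun_prop
  have hQW : ∀ h, ∫ t, ψ t * differenceQuotient r v u h (x - t) = differenceQuotient r v W h x := by
    intro h
    have hi : ∀ e, Integrable fun t => ψ t * u (x + e - t) := fun e => hint _ (by fun_prop)
    have hi0 : Integrable fun t => ψ t * u (x - t) := hint _ (by fun_prop)
    have e1 : ∀ t, ψ t * differenceQuotient r v u h (x - t) =
        ∑ k, (ψ t * u (x + h • r k - t) + ψ t * u (x + -(h • r k) - t)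
          - 2 * (ψ t * u (x - t))) / h ^ 2
        - (ψ t * u (x + h • v - t) - ψ t * u (x - t)) / h := by
      intro t
      have a1 : ∀ e, x - t + e = x + e - t := fun e => by abel
      simp only [differenceQuotient, sub_eq_add_neg (x - t), a1]
      rw [mul_sub, Finset.mul_sum]
      congr 1
      · exact Finset.sum_congr rfl fun k _ => by ring
      · ring
    simp only [e1]
    rw [integral_sub, integral_finsetSum]
    · simp only [integral_div]
      rw [integral_sub (hi _) hi0, ← hW, ← hW, differenceQuotient]
      congr 1
      refine Finset.sum_congr rfl fun k _ => ?_
      have := integral_sub ((hi (h • r k)).add (hi (-(h • r k)))) (hi0.const_mul 2)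
      simp only [Pi.add_apply] at this
      rw [this, integral_add (hi _) (hi _), integral_const_mul, ← hW, ← hW, ← hW, ← sub_eq_add_neg]
    · exact fun k _ => (((hi _).add (hi _)).sub (hi0.const_mul 2)).div_const _
    · exact integrable_finsetSum _ fun k _ =>
        (((hi _).add (hi _)).sub (hi0.const_mul 2)).div_const _
    · exact ((hi _).sub hi0).div_const _
  have hlimW : Tendsto (fun h => differenceQuotient r v W h x) (𝓝[>] 0)
      (𝓝 (∑ k, iteratedFDeriv ℝ 2 W x ![r k, r k] - fderiv ℝ W x v)) := by
    refine Tendsto.sub (tendsto_finsetSum _ fun k _ => ?_) ?_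
    · exact (hWc.tendsto_second_difference x (r k)).mono_left
        (nhdsGT_le_nhdsNE (0 : ℝ))
    · have h1 := (hWc.differentiable (by norm_num) x).hasFDerivAt.hasLineDerivAt v
      have h2 := (hasDerivAt_iff_tendsto_slope.1 h1).mono_left
        (nhdsGT_le_nhdsNE (0 : ℝ))
      refine h2.congr fun t => ?_
      simp [slope, div_eq_inv_mul]
  -- Semiconvexity and the Lipschitz bound give a lower bound uniform in `h`; no upper bound is
  -- available.
  set B : ℝ := ∑ k, δ⁻¹ * ‖r k‖ ^ 2 + L * ‖v‖ with hB
  have hB0 : 0 ≤ B := by positivity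
  have hlow : ∀ h, 0 < h → ∀ y, -B ≤ differenceQuotient r v u h y := by
    intro h hh y
    have h1 : -∑ k, δ⁻¹ * ‖r k‖ ^ 2 ≤
        ∑ k, (u (y + h • r k) + u (y - h • r k) - 2 * u y) / h ^ 2 := by
      rw [← Finset.sum_neg_distrib]
      refine Finset.sum_le_sum fun k _ => ?_
      rw [le_div_iff₀ (by positivity)]
      have := hsc y (h • r k)
      rw [norm_smul, Real.norm_eq_abs, mul_pow, sq_abs] at this
      linarith
    have h2 : (u (y + h • v) - u y) / h ≤ L * ‖v‖ := by
      rw [div_le_iff₀ hh]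
      have := (le_abs_self _).trans (Real.dist_eq _ _ ▸ hu.dist_le_mul (y + h • v) y)
      rw [dist_eq_norm, add_sub_cancel_left, norm_smul, Real.norm_eq_abs, abs_of_pos hh] at this
      linarith
    rw [differenceQuotient]
    linarith
  -- Truncating at `c` supplies the missing upper bound, so dominated convergence applies. As in
  -- Fatou's lemma, only an inequality results, which is why a nonnegative singular part of `D²u`
  -- does no harm.
  have hlim : Tendsto (fun h => ∫ t, ψ t * min (differenceQuotient r v u h (x - t)) c) (𝓝[>] 0)
      (𝓝 (∫ t, ψ t * c)) := by
    refine tendsto_integral_filter_of_dominated_convergence (fun t => ψ t * (B + |c|)) ?_ ?_ ?_ ?_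
    · exact Eventually.of_forall fun h =>
        (hψc.mul ((hQc h).min continuous_const)).aestronglyMeasurable
    · filter_upwards [self_mem_nhdsWithin] with h hh
      refine Eventually.of_forall fun t => ?_
      rw [norm_mul, Real.norm_eq_abs, abs_of_nonneg (hψ0 t)]
      refine mul_le_mul_of_nonneg_left ?_ (hψ0 t)
      refine abs_le.2 ⟨le_min ?_ ?_, (min_le_right _ _).trans ?_⟩
      · linarith [hlow h hh (x - t), abs_nonneg c]
      · linarith [neg_abs_le c]
      · linarith [le_abs_self c]
    · exact hint _ continuous_const
    · have hae' := (Measure.measurePreserving_sub_left (volume : Measure (RSpace n)) x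
        ).quasiMeasurePreserving.ae hae
      filter_upwards [hae'] with t ht
      by_cases hts : t ∈ Function.support ψ
      · rw [hψ, φ.support_normed_eq, mem_ball_zero_iff] at hts
        obtain ⟨l, hl, hlim⟩ := ht (by
          have : x - t - x = -t := by abel
          rwa [this, norm_neg])
        have := (hlim.min (tendsto_const_nhds (x := c))).const_mul (ψ t)
        rwa [min_eq_right hl] at this
      · rw [Function.notMem_support] at hts
        simp [hts]
  have hcint : ∫ t, ψ t * c = c := by
    rw [integral_mul_const, hψ, φ.integral_normed, one_mul]
  rw [hcint] at hlim
  refine le_of_tendsto_of_tendsto hlim hlimW ?_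
  filter_upwards with h
  rw [← hQW]
  refine integral_mono (hint _ ((hQc h).min continuous_const)) (hint _ (hQc h)) fun t => ?_
  exact mul_le_mul_of_nonneg_left (min_le_left _ _) (hψ0 t)

end Mollification

/-! ### Assembly of the regularization and choice of scales. -/

section Main

variable {n : ℕ}

lemma diffusionTerm_add_smul_one (A : RSpace n → Matrix (Fin n) (Fin n) ℝ) (s : ℝ)
    (φ : RSpace n → ℝ) (x : RSpace n) :
    diffusionTerm (fun x => A x + s • 1) φ x =
      diffusionTerm A φ x + s * Laplacian.laplacian φ x := by
  rw [laplacian_eq_iteratedFDeriv_orthonormalBasis φ (EuclideanSpace.basisFun (Fin n) ℝ)]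
  simp [diffusionTerm, add_mul, Matrix.trace, hessianMatrix,
    Finset.sum_add_distrib, Finset.mul_sum]

lemma quadForm_add_smul_one (A : Matrix (Fin n) (Fin n) ℝ) (s : ℝ) (v : RSpace n) :
    quadForm (A + s • 1) v = quadForm A v + s * ‖v‖ ^ 2 := by
  rw [EuclideanSpace.norm_sq_eq]
  simp only [quadForm, Matrix.add_apply, Matrix.smul_apply, smul_eq_mul, add_mul,
    Finset.sum_add_distrib, Matrix.one_apply, Finset.mul_sum, Real.norm_eq_abs, sq_abs]
  congr 1
  refine Finset.sum_congr rfl fun i _ => ?_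
  simp [sq, mul_assoc]

/-- Structural constants of the diffusion matrix: Glaeser's inequality and Lipschitz continuity. -/
lemma exists_diffusion_bounds {A : RSpace n → Matrix (Fin n) (Fin n) ℝ} (hA_per : ZPeriodic A)
    (hA_C2 : ∀ i j, ContDiff ℝ 2 (fun x => A x i j)) (hA_psd : ∀ x, (A x).PosSemidef) :
    ∃ G a₁ : ℝ, 0 ≤ G ∧ 0 ≤ a₁ ∧
      (∀ x y v, |quadForm (A y - A x) v| ≤
        G * (‖y - x‖ * √(quadForm (A x) v) * ‖v‖ + ‖y - x‖ ^ 2 * ‖v‖ ^ 2)) ∧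
      ∀ x y v, |quadForm (A y - A x) v| ≤ a₁ * ‖y - x‖ * ‖v‖ ^ 2 := by
  have hper : ∀ i j, ZPeriodic fun x => A x i j := fun i j k x => by
    have := hA_per k x
    simp only [this]
  choose c hc0 hc using fun i j => (hper i j).exists_quadratic_remainder (hA_C2 i j)
  choose d hd0 hd using fun i j =>
    (hper i j).exists_lipschitz ((hA_C2 i j).of_le (by norm_num : (1 : WithTop ℕ∞) ≤ 2))
  have hle : ∀ (f : Fin n → Fin n → ℝ), (∀ i j, 0 ≤ f i j) → ∀ i j, f i j ≤ ∑ i, ∑ j, f i j :=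
    fun f hf i j => (Finset.single_le_sum (fun j _ => hf i j) (Finset.mem_univ j)).trans
      (Finset.single_le_sum (f := fun i => ∑ j, f i j)
        (fun i _ => Finset.sum_nonneg fun j _ => hf i j) (Finset.mem_univ i))
  obtain ⟨G, hG0, hG⟩ := exists_glaeser_bound hA_psd (c := ∑ i, ∑ j, c i j)
    (Finset.sum_nonneg fun i _ => Finset.sum_nonneg fun j _ => hc0 i j)
    (fun x i j => fderiv ℝ (fun x => A x i j) x) (fun x v i j => (hc i j x v).trans (by
      have := hle c hc0 i j
      gcongr))
  have hd1 : 0 ≤ ∑ i, ∑ j, d i j :=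
    Finset.sum_nonneg fun i _ => Finset.sum_nonneg fun j _ => hd0 i j
  refine ⟨G, n ^ 2 * ∑ i, ∑ j, d i j, hG0, by positivity, hG, fun x y v => ?_⟩
  rw [mul_assoc ((n : ℝ) ^ 2)]
  refine abs_quadForm_le (fun i j => ?_) v
  have h1 := hd i j x y
  have h2 := hle d hd0 i j
  rw [Real.norm_eq_abs] at h1
  refine h1.trans (by gcongr)

/-- The mollified sup-convolution of a subsolution, at regularization scale `η`, satisfies the
inequality with the additional viscosity `K η²`. -/
lemma exists_regularization {H : RSpace n → RSpace n → ℝ}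
    (hH_C2 : ContDiff ℝ 2 (fun z : RSpace n × RSpace n => H z.1 z.2))
    (hH_conv : ∀ x, ConvexOn ℝ Set.univ (H x))
    {A : RSpace n → Matrix (Fin n) (Fin n) ℝ} (hA_psd : ∀ x, (A x).PosSemidef)
    {c₀ : ℝ} {w : RSpace n → ℝ} (hw_per : ZPeriodic w) {L : NNReal} (hw : LipschitzWith L w)
    (hw_sub : IsViscositySubsolution H A c₀ w)
    {G : ℝ} (hG0 : 0 ≤ G)
    (hG : ∀ x y v, |quadForm (A y - A x) v| ≤
      G * (‖y - x‖ * √(quadForm (A x) v) * ‖v‖ + ‖y - x‖ ^ 2 * ‖v‖ ^ 2))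
    {a₁ : ℝ} (ha₁ : 0 ≤ a₁) (hA₁ : ∀ x y v, |quadForm (A y - A x) v| ≤ a₁ * ‖y - x‖ * ‖v‖ ^ 2)
    {κ K : ℝ} (hκ : κ = n * (3 * (G * (2 * L + (2 * L) ^ 2)))) (hK : a₁ + 1 + n * κ ^ 2 ≤ K)
    {h₁ : ℝ} (hh₁ : 0 ≤ h₁)
    (hH₁ : ∀ x y p, ‖p‖ ≤ 2 * L → |H y p - H x p| ≤ h₁ * ‖y - x‖)
    {η : ℝ} (hη : 0 < η) (hη1 : η ≤ 1) :
    ∃ W : RSpace n → ℝ, ContDiff ℝ ∞ W ∧ ZPeriodic W ∧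
      (∀ x, |W x - w x| ≤ (L + (L : ℝ) ^ 2) * η) ∧
      ∀ x, -(K * η ^ 2) * Laplacian.laplacian W x - diffusionTerm A W x + H x (gradient W x) ≤
        c₀ + (n * ((1 + κ) ^ 2 + κ ^ 2) + n * (a₁ + K) + h₁ * (2 * L + 1)) * η := by
  obtain ⟨u, ζ, hu⟩ := hw.exists_isSupConvolution hη
  have hul := hu.lipschitzWith hw
  have hη2 : η ^ 2 ≤ η := by nlinarith
  have hK0 : 0 ≤ K := by
    have : 0 ≤ n * κ ^ 2 := by positivity
    linarith
  set φ : ContDiffBump (0 : RSpace n) :=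
    ⟨η ^ 2 / 2, η ^ 2, by positivity, half_lt_self (by positivity)⟩ with hφ
  set W : RSpace n → ℝ :=
    convolution (φ.normed volume) u (ContinuousLinearMap.lsmul ℝ ℝ) volume with hWdef
  have hW : ∀ x, W x = ∫ t, φ.normed volume t * u (x - t) := fun x => by
    simp [hWdef, convolution_def]
  have hWc : ContDiff ℝ ∞ W :=
    φ.hasCompactSupport_normed.contDiff_convolution_left _ φ.contDiff_normed
      hul.continuous.locallyIntegrable
  have hf : ∀ x, IsSubgradient (fun x => u x + ‖x‖ ^ 2 / (2 * η)) x (η⁻¹ • ζ x) :=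
    fun x => hu.isSubgradient hη x
  have hsc : ∀ y e, -(η⁻¹ * ‖e‖ ^ 2) ≤ u (y + e) + u (y - e) - 2 * u y := by
    intro y e
    have h1 := (hf y).second_difference_nonneg e
    simp only [norm_add_sq_real, norm_sub_sq_real] at h1
    have b10 : ∀ s : ℝ, s / (2 * η) = η⁻¹ * s / 2 := fun s => by field_simp
    simp only [b10] at h1
    linarith
  refine ⟨W, hWc, fun k x => ?_, fun x => ?_, fun x => ?_⟩
  · rw [hW, hW]
    congr 1
    funext t
    rw [add_sub_right_comm, hu.add_right_eq (fun x => hw_per k x)]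
  · have h1 : |W x - u x| ≤ L * η ^ 2 := by
      rw [← Real.dist_eq]
      refine φ.dist_normed_convolution_le hul.continuous.aestronglyMeasurable fun y hy => ?_
      refine (hul.dist_le_mul y x).trans ?_
      have : dist y x ≤ η ^ 2 := (Metric.mem_ball.1 hy).le
      gcongr
    have h2 := hu.self_le x
    have h3 := hu.le_add hw hη x
    have h4 : (L : ℝ) * η ^ 2 ≤ L * η := by gcongr
    have h5 : 0 ≤ (L : ℝ) ^ 2 * η := by positivity
    have h6 := abs_le.1 h1
    exact abs_le.2 ⟨by linarith, by linarith⟩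
  · have hB : (A x + (K * η ^ 2) • (1 : Matrix (Fin n) (Fin n) ℝ)).PosSemidef :=
      (hA_psd x).add (Matrix.PosSemidef.one.smul (by positivity))
    obtain ⟨m, r, hr⟩ := hB.exists_eq_sum
    set p₀ := gradient W x with hp₀
    -- The tangent plane of `H x` at `p₀ = DW(x)` lies below `H x` and agrees with it at `p₀`.
    -- Replacing `H x` by it makes the inequality at nearby `y` affine in `(Du, D²u)` with
    -- coefficients frozen at `x`.
    set v := gradient (H x) p₀ with hv
    have hHx : ContDiff ℝ 2 (H x) := hH_C2.comp (contDiff_const.prodMk contDiff_id)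
    have htan := (hH_conv x).add_inner_gradient_le (hHx.differentiable (by norm_num) p₀)
    rw [← hv] at htan
    set C := n * ((1 + κ) ^ 2 + κ ^ 2) + n * (a₁ + K) with hC
    have key := le_of_ae_le_differenceQuotient hul hη hsc φ hW (contDiff_infty.1 hWc 2)
      r v x (c := H x p₀ - ⟪v, p₀⟫_ℝ - c₀ - (C + h₁ * (2 * L + 1)) * η) (by
        have hcf : Continuous fun x => u x + ‖x‖ ^ 2 / (2 * η) := by
          have := hul.continuous
          fun_prop
        filter_upwards [ae_exists_hasFDerivAt_subgradient volume hcf hf] with y hy hyx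
        obtain ⟨Y, hY⟩ := hy
        set p := η⁻¹ • (ζ y - y) with hp
        set q : RSpace n → ℝ := fun e => ⟪Y e, e⟫_ℝ - η⁻¹ * ‖e‖ ^ 2 with hq
        have hqt : ∀ (t : ℝ) e, q (t • e) = t ^ 2 * q e := fun t e => by
          simp only [hq, map_smul, real_inner_smul_left, real_inner_smul_right, norm_smul,
            mul_pow, Real.norm_eq_abs, sq_abs]
          ring
        have hexp : (fun e => u (y + e) - u y - innerSL ℝ p e - q e / 2) =o[𝓝 0]
            fun e => ‖e‖ ^ 2 := by
          refine (expansion_of_hasFDerivAt_subgradient hf hY).congr_left fun e => ?_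
          have b10 : ∀ s : ℝ, s / (2 * η) = η⁻¹ * s / 2 := fun s => by field_simp
          simp only [b10, norm_add_sq_real, hq, hp, innerSL_apply_apply, real_inner_smul_left,
            inner_sub_left]
          ring
        refine ⟨∑ k, q (r k) - ⟪p, v⟫_ℝ, ?_, ?_⟩
        · have hyx' : ‖y - x‖ ≤ η ^ 2 := hyx.le
          have h1 := hw_sub.le_sum_second_order hA_psd hw hη hu hG0 hG ha₁ hA₁ hκ hK hyx' hY
            (r := r) (fun e => by
              rw [sum_inner_sq_eq_quadForm hr, quadForm_add_smul_one])
          have h2 := hu.norm_sub_le hw hη y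
          have hpn : ‖p‖ ≤ 2 * L := by
            rw [hp, norm_smul, norm_inv, Real.norm_eq_abs, abs_of_pos hη, norm_sub_rev,
              inv_mul_le_iff₀ hη]
            linarith
          have h3 : ‖ζ y - x‖ ≤ (2 * L + 1) * η := by
            have : ζ y - x = (y - x) - (y - ζ y) := by abel
            rw [this]
            refine (norm_sub_le _ _).trans ?_
            linarith
          have h4 := (abs_le.1 (hH₁ x (ζ y) p hpn)).1
          have h5 := mul_le_mul_of_nonneg_left h3 hh₁
          have h6 := htan p
          rw [inner_sub_right, real_inner_comm p v] at h6
          simp only [hq]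
          linarith
        · refine Tendsto.sub (tendsto_finsetSum _ fun k _ => ?_) ?_
          · exact (tendsto_second_difference_of_expansion (f := u) hqt hexp (r k)).mono_left
              (nhdsGT_le_nhdsNE (0 : ℝ))
          · exact (tendsto_first_difference_of_expansion (f := u) hqt hexp v).mono_left
              (nhdsGT_le_nhdsNE (0 : ℝ)))
    have e1 := diffusionTerm_eq_sum (A := fun x => A x + (K * η ^ 2) • 1) hr W
    rw [diffusionTerm_add_smul_one] at e1
    have e2 : fderiv ℝ W x v = ⟪v, p₀⟫_ℝ := by
      have := (hWc.differentiable (by simp) x).hasGradientAt.hasFDerivAt.fderiv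
      rw [this, real_inner_comm]
      simp [hp₀]
    rw [← e1, e2] at key
    linarith

end Main
end Regularization

theorem theorem4p1 (n : ℕ)
    (H : RSpace n → RSpace n → ℝ)
    (hH_per : ZPeriodic H)
    (hH_C2 : ContDiff ℝ 2 (fun z : RSpace n × RSpace n => H z.1 z.2))
    (hH_conv : ∀ x, StrictConvexOn ℝ Set.univ (H x))
    (hH_superlinear : ∀ x,
      Filter.Tendsto (fun p => H x p / ‖p‖) (Bornology.cobounded (RSpace n)) Filter.atTop)
    (hH_growth : ∃ γ₁ : ℝ, 0 < γ₁ ∧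
      ∀ x p, ‖gradient (fun y => H y p) x‖ ≤ γ₁ * (1 + |H x p|))
    (A : RSpace n → Matrix (Fin n) (Fin n) ℝ)
    (hA_per : ZPeriodic A)
    (hA_C2 : ∀ i j, ContDiff ℝ 2 (fun x => A x i j))
    (hA_psd : ∀ x, (A x).PosSemidef)
    (c₀ : ℝ)
    (w : RSpace n → ℝ)
    (hw_per : ZPeriodic w)
    (hw_lip : ∃ L : NNReal, LipschitzWith L w)
    (hw_sub : IsViscositySubsolution H A c₀ w) :
    ∃ C : ℝ, 0 < C ∧ ∀ η ∈ Set.Ioo (0 : ℝ) 1,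
      ∃ wreg : RSpace n → ℝ, ContDiff ℝ ∞ wreg ∧ ZPeriodic wreg ∧
        (∀ x, |wreg x - w x| ≤ C * η) ∧
        (∀ x, -η ^ 2 * Laplacian.laplacian wreg x - diffusionTerm A wreg x
            + H x (gradient wreg x) ≤ c₀ + C * η) := by
  obtain ⟨L, hL⟩ := hw_lip
  obtain ⟨G, a₁, hG0, ha₁, hG, hA₁⟩ := exists_diffusion_bounds hA_per hA_C2 hA_psd
  obtain ⟨h₁, hh₁, hH₁⟩ := exists_lipschitz_of_gradient_growth hH_per hH_C2 hH_growth (2 * L)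
  set κ : ℝ := n * (3 * (G * (2 * L + (2 * L) ^ 2))) with hκ
  set K₁ : ℝ := a₁ + 1 + n * κ ^ 2 with hK₁
  have hκ2 : 0 ≤ n * κ ^ 2 := by positivity
  have hK1 : 1 ≤ K₁ := by linarith
  have hK0 : 0 < K₁ := by linarith
  set C : ℝ := n * ((1 + κ) ^ 2 + κ ^ 2) + n * (a₁ + K₁ ^ 2) + h₁ * (2 * L + 1) with hC
  have hC0 : 0 ≤ C := by positivity
  refine ⟨C + (L + (L : ℝ) ^ 2) + 1, by positivity, fun η hη => ?_⟩
  have hηK : η / K₁ ≤ η := div_le_self hη.1.le hK1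
  -- At scale `η / K₁` with `K = K₁²` the added viscosity is `K₁² (η / K₁)² = η²`; the requirement
  -- `K₁ ≤ K` holds because `K₁ ≥ 1`.
  obtain ⟨W, hWc, hWp, hWw, hWH⟩ := exists_regularization hH_C2
    (fun x => (hH_conv x).convexOn) hA_psd hw_per hL hw_sub hG0 hG ha₁ hA₁ hκ
    (K := K₁ ^ 2) (by nlinarith) hh₁ hH₁ (η := η / K₁) (div_pos hη.1 hK0) (hηK.trans hη.2.le)
  have hL0 : (0 : ℝ) ≤ L + (L : ℝ) ^ 2 := by positivity
  have b1 := mul_le_mul_of_nonneg_left hηK hL0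
  have b2 := mul_le_mul_of_nonneg_left hηK hC0
  have b3 := mul_nonneg hL0 hη.1.le
  have b4 := mul_nonneg hC0 hη.1.le
  have hη0 := hη.1
  refine ⟨W, hWc, hWp, fun x => (hWw x).trans (by linarith), fun x => ?_⟩
  have h1 := hWH x
  have e : K₁ ^ 2 * (η / K₁) ^ 2 = η ^ 2 := by field_simp
  rw [e] at h1
  linarith
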